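/- Let $G$ be a connected real linear reductive Lie group, i.e. (up to isomorphism) a closed connected subgroup of $\mathrm{GL}(n,\mathbb{R})$ stable under transposition. Let $\mathfrak{g}$ be its Lie algebra, $K=G\cap \mathrm{O}(n)$, $\mathfrak{p}=\{X\in\mathfrak{g} : X^{T}=X\}$, let $\mathfrak{a}$ be a maximal abelian subspace of $\mathfrak{p}$, let $\Delta$ be a system of simple restricted roots of $\mathfrak{a}$ in $\mathfrak{g}$ (a linearly independent set of restricted roots such that every restricted root is a linear combination of elements of $\Delta$ with all coefficients $\geq 0$ or all $\leq 0$), let $\mathfrak{a}^+=\{a\in\mathfrak{a} : \alpha(a)\ge 0\ \forall \alpha\in\Delta\}$, and let $\mu:G\to\mathfrak{a}^+$ be the Cartan projection, so that $\mu(g)$ is the unique element of $\mathfrak{a}^+$ with $g\in K\exp(\mu(g))K$. Let $\|\cdot\|$ be any Euclidean norm on $\mathfrak{a}$, with distance function $d_{\mathfrak{a}}$. Let $H$ be a closed subgroup of $G$. For a compactly generated topological group $\Gamma$ and a compact symmetric generating set $S$ containing a neighbourhood of the identity, put $|\gamma|_S=\min\{n\in\mathbb{N} : \gamma\in S^n\}$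 and $d_S(\gamma,\gamma')=|\gamma^{-1}\gamma'|_S$. A closed subgroup $\Gamma$ of $G$ is called * *sharply embedded in $G$ with respect to $H$* if it is compactly generated and for every such $S$ there are $C,C'>0$ with $d_{\mathfrak{a}}(\mu(\gamma),\mu(H))\ge C|\gamma|_S-C'$ for all $\gamma\in\Gamma$; * *sharp for $G/H$* if there are $c,c'>0$ with $d_{\mathfrak{a}}(\mu(\gamma),\mu(H))\ge c\|\mu(\gamma)\|-c'$ for all $\gamma\in\Gamma$; * *quasi-isometrically embedded in $G$* if it is compactly generated and the inclusion $\Gamma\hookrightarrow G$ is a quasi-isometric embedding for the word distances of $\Gamma$ and $G$. Then: 1. Every discrete subgroup $\Gamma$ of $G$ acting properly discontinuously and cocompactly on $G/H$ is finitely generated and sharply embedded in $G$ with respect to $H$; in particular it is sharp for $G/H$ and quasi-isometrically embedded in $G$. 2. Every closed (not necessarily discrete) subgroup $\Gamma$ of $G$ acting properly and cocompactly on $G/H$ is compactly generated and sharply embedded in $G$ with respect to $H$; in particular it is sharp for $G/H$ and quasi-isometrically embedded in $G$. 3. A closed compactly generated subgroup $\Gamma$ of $G$ is sharply embedded in $G$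 with respect to $H$ if and only if it is sharp for $G/H$ and quasi-isometrically embedded in $G$. -/

import Mathlib

open scoped Pointwise Topology NNReal Matrix

/-! ### Compactly generated groups and word lengths -/

/-- A topological group is compactly generated if some compact subset generates it. -/
def IsCompactlyGeneratedGroup (Γ : Type*) [Group Γ] [TopologicalSpace Γ] : Prop :=
  ∃ S : Set Γ, IsCompact S ∧ Subgroup.closure S = ⊤

/-- The generating sets used to measure word length: compact, symmetric, generating, and
containing a neighbourhood of the identity. In a discrete group these are the finite symmetric
generating sets that contain the identity. -/
structure IsWordGeneratingSet {Γ : Type*} [Group Γ] [TopologicalSpace Γ] (S : Set Γ) : Prop where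
  isCompact : IsCompact S
  inv_eq : S⁻¹ = S
  mem_nhds_one : S ∈ 𝓝 (1 : Γ)
  closure_eq_top : Subgroup.closure S = ⊤

/-- The word length `|γ|_S = inf {n | γ ∈ S ^ n}`, where `S ^ n` is the set of products of `n`
elements of `S` and `S ^ 0 = {1}`. -/
noncomputable def wordLength {Γ : Type*} [Group Γ] (S : Set Γ) (γ : Γ) : ℕ :=
  sInf {n : ℕ | γ ∈ S ^ n}

/-- The left-invariant word distance `d_S(γ, γ') = |γ⁻¹ γ'|_S`. -/
noncomputable def wordDist {Γ : Type*} [Group Γ] (S : Set Γ) (γ γ' : Γ) : ℕ :=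
  wordLength S (γ⁻¹ * γ')

/-- The inclusion of the subgroup `Γ` into `G` is a quasi-isometric embedding, where `Γ` and `G`
are compactly generated and carry word distances. -/
def IsQuasiIsometricallyEmbedded {G : Type*} [Group G] [TopologicalSpace G]
    (Γ : Subgroup G) : Prop :=
  IsCompactlyGeneratedGroup Γ ∧ IsCompactlyGeneratedGroup G ∧
    ∀ (S : Set Γ) (T : Set G), IsWordGeneratingSet S → IsWordGeneratingSet T →
      ∃ A B : ℝ, 1 ≤ A ∧ 0 ≤ B ∧ ∀ γ γ' : Γ,
        A⁻¹ * (wordDist S γ γ' : ℝ) - B ≤ (wordDist T (γ : G) (γ' : G) : ℝ) ∧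
        (wordDist T (γ : G) (γ' : G) : ℝ) ≤ A * (wordDist S γ γ' : ℝ) + B

/-! ### Real linear reductive groups and Cartan projections -/

/-- A realization of the topological group `G` as a real linear reductive Lie group: an
isomorphism of `G` onto a closed group of real invertible matrices that is stable under
transposition. The corresponding Cartan involution is `g ↦ (gᵀ)⁻¹`. -/
structure LinearReductive (G : Type*) [Group G] [TopologicalSpace G]
    (ι : Type*) [Fintype ι] [DecidableEq ι] where
  /-- the embedding in the general linear group -/
  toGL : G →* GL ι ℝ
  isClosedEmbedding : Topology.IsClosedEmbedding toGL
  transpose_mem : ∀ g : G, ∃ g' : G,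
    ((toGL g' : GL ι ℝ) : Matrix ι ι ℝ) = ((toGL g : GL ι ℝ) : Matrix ι ι ℝ)ᵀ

namespace LinearReductive

variable {G : Type*} [Group G] [TopologicalSpace G] {ι : Type*} [Fintype ι] [DecidableEq ι]

/-- The matrix of an element of `G`. -/
def mat (R : LinearReductive G ι) (g : G) : Matrix ι ι ℝ := ((R.toGL g : GL ι ℝ) : Matrix ι ι ℝ)

/-- The maximal compact subgroup `K` of orthogonal matrices in `G`, i.e. the fixed points of the
Cartan involution. -/
def maximalCompact (R : LinearReductive G ι) : Set G :=
  {k | R.mat k ∈ Matrix.orthogonalGroup ι ℝ}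

/-- The Lie algebra `𝔤` of `G`: the matrices whose one-parameter group lies in `G`. -/
def lieAlg (R : LinearReductive G ι) : Set (Matrix ι ι ℝ) :=
  {X | ∀ t : ℝ, ∃ g : G, R.mat g = NormedSpace.exp (t • X)}

/-- The part `𝔭` of the Cartan decomposition `𝔤 = 𝔨 ⊕ 𝔭`: the symmetric matrices in `𝔤`, i.e. the
anti-fixed points `X = -(-Xᵀ)` of the differential `X ↦ -Xᵀ` of the Cartan involution. -/
def lieP (R : LinearReductive G ι) : Set (Matrix ι ι ℝ) :=
  {X | X ∈ R.lieAlg ∧ Xᵀ = X}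

/-- `𝔟` is an abelian subspace of `𝔭`. -/
def IsAbelianInP (R : LinearReductive G ι) (𝔟 : Submodule ℝ (Matrix ι ι ℝ)) : Prop :=
  (𝔟 : Set (Matrix ι ι ℝ)) ⊆ R.lieP ∧ ∀ X ∈ 𝔟, ∀ Y ∈ 𝔟, ⁅X, Y⁆ = 0

/-- A Cartan subspace: a maximal abelian subspace of `𝔭`. -/
def IsCartanSubspace (R : LinearReductive G ι) (𝔞 : Submodule ℝ (Matrix ι ι ℝ)) : Prop :=
  Maximal R.IsAbelianInP 𝔞

/-- The set `Σ` of restricted roots of `𝔞` in `𝔤`. -/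
def restrictedRoots (R : LinearReductive G ι) (𝔞 : Submodule ℝ (Matrix ι ι ℝ)) :
    Set (Module.Dual ℝ 𝔞) :=
  {α | α ≠ 0 ∧ ∃ v ∈ R.lieAlg, v ≠ 0 ∧
    ∀ a : 𝔞, ⁅(a : Matrix ι ι ℝ), v⁆ = α a • v}

/-- `Δ` is a system of simple restricted roots: a linearly independent set of restricted roots
such that every restricted root is a linear combination of elements of `Δ` with all coefficients
nonnegative or all coefficients nonpositive. -/
structure IsSimpleSystem (R : LinearReductive G ι) (𝔞 : Submodule ℝ (Matrix ι ι ℝ))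
    (Δ : Set (Module.Dual ℝ 𝔞)) : Prop where
  subset : Δ ⊆ R.restrictedRoots 𝔞
  linearIndependent : LinearIndependent ℝ ((↑) : Δ → Module.Dual ℝ 𝔞)
  pos_or_neg : ∀ α ∈ R.restrictedRoots 𝔞,
    α ∈ Submodule.span ℝ≥0 Δ ∨ -α ∈ Submodule.span ℝ≥0 Δ

/-- The closed positive Weyl chamber `𝔞⁺` defined by `Δ`. -/
def weylChamber (𝔞 : Submodule ℝ (Matrix ι ι ℝ)) (Δ : Set (Module.Dual ℝ 𝔞)) : Set 𝔞 :=
  {a | ∀ α ∈ Δ, 0 ≤ α a}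

/-- `a` is a Cartan component of `g`: it lies in `𝔞⁺` and `g ∈ K exp(a) K`. -/
def IsCartanComponent (R : LinearReductive G ι) (𝔞 : Submodule ℝ (Matrix ι ι ℝ))
    (Δ : Set (Module.Dual ℝ 𝔞)) (g : G) (a : 𝔞) : Prop :=
  a ∈ weylChamber 𝔞 Δ ∧ ∃ k ∈ R.maximalCompact, ∃ k' ∈ R.maximalCompact,
    R.mat g = R.mat k * NormedSpace.exp (a : Matrix ι ι ℝ) * R.mat k'

open Classical in
/-- The Cartan projection `μ : G → 𝔞⁺`: `μ(g)` is the element `a` of `𝔞⁺` with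
`g ∈ K exp(a) K`. (It exists and is unique by the Cartan decomposition.) -/
noncomputable def cartanProjection (R : LinearReductive G ι) (𝔞 : Submodule ℝ (Matrix ι ι ℝ))
    (Δ : Set (Module.Dual ℝ 𝔞)) (g : G) : 𝔞 :=
  if h : ∃ a : 𝔞, R.IsCartanComponent 𝔞 Δ g a then h.choose else 0

end LinearReductive

/-! ### Euclidean norms, sharpness and sharp embeddings -/

/-- `B` is a scalar product. -/
structure IsScalarProduct {E : Type*} [AddCommGroup E] [Module ℝ E]
    (B : LinearMap.BilinForm ℝ E) : Prop where
  symm : ∀ x y, B x y = B y x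
  pos : ∀ x, x ≠ 0 → 0 < B x x

/-- The Euclidean norm of a scalar product. -/
noncomputable def euclNorm {E : Type*} [AddCommGroup E] [Module ℝ E]
    (B : LinearMap.BilinForm ℝ E) (x : E) : ℝ := Real.sqrt (B x x)

/-- The distance from `x` to a nonempty set `s`, for the Euclidean norm of `B`. -/
noncomputable def euclDistTo {E : Type*} [AddCommGroup E] [Module ℝ E]
    (B : LinearMap.BilinForm ℝ E) (x : E) (s : Set E) : ℝ := ⨅ y : s, euclNorm B (x - y)

namespace LinearReductive

variable {G : Type*} [Group G] [TopologicalSpace G] {ι : Type*} [Fintype ι] [DecidableEq ι]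

/-- `Γ` is sharp for `G/H`. -/
def IsSharp (R : LinearReductive G ι) (𝔞 : Submodule ℝ (Matrix ι ι ℝ))
    (Δ : Set (Module.Dual ℝ 𝔞)) (B : LinearMap.BilinForm ℝ 𝔞) (Γ H : Subgroup G) : Prop :=
  ∃ c c' : ℝ, 0 < c ∧ 0 < c' ∧ ∀ γ ∈ Γ,
    c * euclNorm B (R.cartanProjection 𝔞 Δ γ) - c' ≤
      euclDistTo B (R.cartanProjection 𝔞 Δ γ) (R.cartanProjection 𝔞 Δ '' (H : Set G))

/-- `Γ` is compactly generated and sharply embedded in `G` with respect to `H`; the inequality is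
required for every choice of the generating set `S` (the constants may depend on `S`). -/
def IsSharplyEmbedded (R : LinearReductive G ι) (𝔞 : Submodule ℝ (Matrix ι ι ℝ))
    (Δ : Set (Module.Dual ℝ 𝔞)) (B : LinearMap.BilinForm ℝ 𝔞) (Γ H : Subgroup G) : Prop :=
  IsCompactlyGeneratedGroup Γ ∧ ∀ S : Set Γ, IsWordGeneratingSet S →
    ∃ C C' : ℝ, 0 < C ∧ 0 < C' ∧ ∀ γ : Γ,
      C * (wordLength S γ : ℝ) - C' ≤
        euclDistTo B (R.cartanProjection 𝔞 Δ (γ : G)) (R.cartanProjection 𝔞 Δ '' (H : Set G))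

end LinearReductive

/-- The subgroup `Γ` acts cocompactly on `G/H`: the quotient `Γ\G/H` is compact. -/
def ActsCocompactly {G : Type*} [Group G] [TopologicalSpace G] (Γ H : Subgroup G) : Prop :=
  CompactSpace (Quotient (MulAction.orbitRel Γ (G ⧸ H)))

/-! ### The Frobenius norm, as a norm inducing the usual topology of matrices -/

namespace MatrixFrobenius

variable {ι : Type*} [Fintype ι] [DecidableEq ι]

/-- The Frobenius metric, with the product topology of matrices as underlying topology. -/
noncomputable abbrev metricSpace : MetricSpace (Matrix ι ι ℝ) :=
  Matrix.frobeniusNormedAddCommGroup.toMetricSpace.replaceTopology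
    (U := instTopologicalSpaceMatrix) rfl

/-- The Frobenius norm as a norm of rings. -/
noncomputable scoped instance normedRing : NormedRing (Matrix ι ι ℝ) :=
  { metricSpace, Matrix.instRing with
    norm := fun A => Matrix.frobeniusNormedAddCommGroup.norm A
    dist_eq := Matrix.frobeniusNormedAddCommGroup.dist_eq
    norm_mul_le := Matrix.frobenius_norm_mul }

theorem norm_sq_eq_trace (A : Matrix ι ι ℝ) : ‖A‖ ^ 2 = Matrix.trace (Aᵀ * A) := by
  have h : ‖A‖ = (∑ i, ∑ j, ‖A i j‖ ^ (2 : ℝ)) ^ (1 / 2 : ℝ) := Matrix.frobenius_norm_def A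
  rw [h, ← Real.sqrt_eq_rpow, Real.sq_sqrt (by positivity), Finset.sum_comm]
  simp [Matrix.trace, Matrix.mul_apply, sq]

/-- Matrices with the Frobenius norm form a normed algebra. -/
noncomputable scoped instance normedAlgebra : NormedAlgebra ℝ (Matrix ι ι ℝ) :=
  { Matrix.instAlgebra with
    norm_smul_le := fun r A => by
      have h : ‖r • A‖ ^ 2 = (|r| * ‖A‖) ^ 2 := by
        rw [mul_pow, norm_sq_eq_trace, norm_sq_eq_trace]; simp [sq, mul_assoc]
      exact ((sq_eq_sq₀ (norm_nonneg _) (by positivity)).1 h).le }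

/-- The scalar product `(A, B) ↦ tr (Aᵀ B)`. -/
noncomputable scoped instance innerProductSpace : InnerProductSpace ℝ (Matrix ι ι ℝ) :=
  { normedAlgebra.toNormedSpace with
    inner := fun A B => Matrix.trace (Aᵀ * B)
    norm_sq_eq_re_inner := fun A => by simpa using norm_sq_eq_trace A
    conj_inner_symm := fun A B => by simp [← Matrix.trace_transpose (Bᵀ * A)]
    add_left := fun A B C => by simp [Matrix.transpose_add, add_mul]
    smul_left := fun A B r => by simp }

/-- The rational normed algebra structure. -/
noncomputable scoped instance normedAlgebraRat : NormedAlgebra ℚ (Matrix ι ι ℝ) :=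
  NormedAlgebra.restrictScalars ℚ ℝ _

scoped instance completeSpace :
    @CompleteSpace (Matrix ι ι ℝ) (normedRing.toMetricSpace.toUniformSpace) :=
  FiniteDimensional.complete ℝ _

theorem inner_def (A B : Matrix ι ι ℝ) : inner ℝ A B = Matrix.trace (Aᵀ * B) := rfl

end MatrixFrobenius

section MatrixFrobeniusNorm

open scoped MatrixFrobenius

namespace Matrix

variable {ι : Type*} [Fintype ι] [DecidableEq ι]

theorem norm_sq_eq_sum (A : Matrix ι ι ℝ) : ‖A‖ ^ 2 = ∑ i, ∑ j, A i j ^ 2 := by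
  rw [MatrixFrobenius.norm_sq_eq_trace, Finset.sum_comm]
  simp [Matrix.trace, Matrix.mul_apply, sq]

theorem norm_transpose_eq (A : Matrix ι ι ℝ) : ‖Aᵀ‖ = ‖A‖ := by
  rw [← sq_eq_sq₀ (norm_nonneg _) (norm_nonneg _), norm_sq_eq_sum, norm_sq_eq_sum,
    Finset.sum_comm]
  rfl

theorem norm_orthogonal_mul {k : Matrix ι ι ℝ} (hk : k ∈ orthogonalGroup ι ℝ)
    (A : Matrix ι ι ℝ) : ‖k * A‖ = ‖A‖ := by
  rw [← sq_eq_sq₀ (norm_nonneg _) (norm_nonneg _), MatrixFrobenius.norm_sq_eq_trace,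
    MatrixFrobenius.norm_sq_eq_trace]
  have h : kᵀ * k = 1 := (mem_orthogonalGroup_iff' ι ℝ).1 hk
  rw [transpose_mul, mul_assoc, ← mul_assoc kᵀ, h, one_mul]

theorem norm_mul_orthogonal {k : Matrix ι ι ℝ} (hk : k ∈ orthogonalGroup ι ℝ)
    (A : Matrix ι ι ℝ) : ‖A * k‖ = ‖A‖ := by
  have h : kᵀ ∈ orthogonalGroup ι ℝ := by
    rw [mem_orthogonalGroup_iff]
    simpa using (mem_orthogonalGroup_iff' ι ℝ).1 hk
  rw [← norm_transpose_eq, transpose_mul, norm_orthogonal_mul h, norm_transpose_eq]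

theorem exists_orthogonal_diagonal {X : Matrix ι ι ℝ} (hX : Xᵀ = X) :
    ∃ U ∈ orthogonalGroup ι ℝ, ∃ d : ι → ℝ, X = U * diagonal d * Uᵀ := by
  have h : X.IsHermitian := by simpa [IsHermitian] using hX
  refine ⟨h.eigenvectorUnitary, h.eigenvectorUnitary.2, h.eigenvalues, ?_⟩
  conv_lhs => rw [h.spectral_theorem]
  rw [Unitary.conjStarAlgAut_apply]
  rfl

variable {U : Matrix ι ι ℝ}

theorem orthogonal_transpose_mul (hU : U ∈ orthogonalGroup ι ℝ) : Uᵀ * U = 1 :=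
  (mem_orthogonalGroup_iff' ι ℝ).1 hU

theorem orthogonal_mul_transpose (hU : U ∈ orthogonalGroup ι ℝ) : U * Uᵀ = 1 :=
  (mem_orthogonalGroup_iff ι ℝ).1 hU

theorem orthogonal_transpose_mem (hU : U ∈ orthogonalGroup ι ℝ) :
    Uᵀ ∈ orthogonalGroup ι ℝ := by
  rw [mem_orthogonalGroup_iff]
  simpa using orthogonal_transpose_mul hU

theorem orthogonal_inv (hU : U ∈ orthogonalGroup ι ℝ) : U⁻¹ = Uᵀ :=
  inv_eq_right_inv (orthogonal_mul_transpose hU)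

theorem orthogonal_isUnit (hU : U ∈ orthogonalGroup ι ℝ) : IsUnit U :=
  IsUnit.of_mul_eq_one _ (orthogonal_mul_transpose hU)

theorem exp_orthogonal_conj (hU : U ∈ orthogonalGroup ι ℝ) (A : Matrix ι ι ℝ) :
    NormedSpace.exp (U * A * Uᵀ) = U * NormedSpace.exp A * Uᵀ := by
  have := exp_conj U A (orthogonal_isUnit hU)
  rwa [orthogonal_inv hU] at this

theorem exp_orthogonal_diagonal (hU : U ∈ orthogonalGroup ι ℝ) (d : ι → ℝ) :
    NormedSpace.exp (U * diagonal d * Uᵀ) = U * diagonal (fun i => Real.exp (d i)) * Uᵀ := by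
  rw [exp_orthogonal_conj hU, exp_diagonal]
  congr 3
  funext i
  rw [Pi.coe_exp, Real.exp_eq_exp_ℝ]

/-- A symmetric positive definite matrix of the form `Aᵀ A` has a symmetric logarithm. -/
theorem exists_symm_exp_eq {A : Matrix ι ι ℝ} (hA : IsUnit A) :
    ∃ X : Matrix ι ι ℝ, Xᵀ = X ∧ NormedSpace.exp X = Aᵀ * A := by
  obtain ⟨U, hU, d, hd⟩ := exists_orthogonal_diagonal (X := Aᵀ * A) (by simp)
  have hpos : ∀ i, 0 < d i := by
    intro i
    have h1 : diagonal d = (A * U)ᵀ * (A * U) := by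
      calc diagonal d = (Uᵀ * U) * diagonal d * (Uᵀ * U) := by
            rw [orthogonal_transpose_mul hU]; simp
        _ = Uᵀ * (U * diagonal d * Uᵀ) * U := by simp only [mul_assoc]
        _ = (A * U)ᵀ * (A * U) := by rw [← hd]; simp only [transpose_mul, mul_assoc]
    have h2 : d i = ∑ j, (A * U) j i ^ 2 := by
      have := congrFun (congrFun h1 i) i
      rw [diagonal_apply_eq, mul_apply] at this
      simpa [sq] using this
    have h3 : 0 ≤ d i := by rw [h2]; positivity
    refine lt_of_le_of_ne h3 fun h0 => ?_
    have hu : IsUnit (diagonal d) := by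
      have hAU := hA.mul (orthogonal_isUnit hU)
      rw [h1]
      exact ((isUnit_transpose _).2 hAU).mul hAU
    rw [isUnit_diagonal, Pi.isUnit_iff] at hu
    exact (hu i).ne_zero h0.symm
  refine ⟨U * diagonal (fun i => Real.log (d i)) * Uᵀ, by simp [mul_assoc], ?_⟩
  rw [exp_orthogonal_diagonal hU, hd]
  simp only [Real.exp_log (hpos _)]

/-- In eigenbases, left multiplication by `x` and right multiplication by `y`
are diagonal; this compares `sinh` of their difference with the difference. -/
theorem norm_intertwine_le {x y k : Matrix ι ι ℝ} (hx : xᵀ = x) (hy : yᵀ = y) :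
    2 * ‖x * k - k * y‖ ≤ ‖NormedSpace.exp (-x) * k * NormedSpace.exp y -
      NormedSpace.exp x * k * NormedSpace.exp (-y)‖ := by
  obtain ⟨U, hU, d, rfl⟩ := exists_orthogonal_diagonal hx
  obtain ⟨V, hV, e, rfl⟩ := exists_orthogonal_diagonal hy
  have key : ∀ p q : ι → ℝ, U * diagonal p * Uᵀ * k * (V * diagonal q * Vᵀ) =
      U * (diagonal p * (Uᵀ * k * V) * diagonal q) * Vᵀ := fun p q => by
    simp only [mul_assoc]
  have hneg : ∀ (W : Matrix ι ι ℝ) (p : ι → ℝ),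
      -(W * diagonal p * Wᵀ) = W * diagonal (fun i => - p i) * Wᵀ := fun W p => by
    have : diagonal (fun i => - p i) = - diagonal p := by simp [← diagonal_neg]
    simp only [this, mul_neg, neg_mul]
  have h1 : U * diagonal d * Uᵀ * k - k * (V * diagonal e * Vᵀ) =
      U * (diagonal d * (Uᵀ * k * V) - (Uᵀ * k * V) * diagonal e) * Vᵀ := by
    have a1 : U * (diagonal d * (Uᵀ * k * V)) * Vᵀ = U * diagonal d * Uᵀ * k * (V * Vᵀ) := by
      simp only [mul_assoc]
    have a2 : U * ((Uᵀ * k * V) * diagonal e) * Vᵀ = U * Uᵀ * (k * (V * diagonal e * Vᵀ)) := by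
      simp only [mul_assoc]
    rw [mul_sub, sub_mul, a1, a2, orthogonal_mul_transpose hU, orthogonal_mul_transpose hV]
    simp
  rw [h1, hneg, hneg, exp_orthogonal_diagonal hU, exp_orthogonal_diagonal hU,
    exp_orthogonal_diagonal hV, exp_orthogonal_diagonal hV, key, key, ← sub_mul, ← mul_sub,
    norm_mul_orthogonal (orthogonal_transpose_mem hV), norm_orthogonal_mul hU,
    norm_mul_orthogonal (orthogonal_transpose_mem hV), norm_orthogonal_mul hU]
  generalize Uᵀ * k * V = W
  refine le_of_sq_le_sq ?_ (norm_nonneg _)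
  rw [mul_pow, norm_sq_eq_sum, norm_sq_eq_sum, Finset.mul_sum]
  refine Finset.sum_le_sum fun i _ => ?_
  rw [Finset.mul_sum]
  refine Finset.sum_le_sum fun j _ => ?_
  have e1 : (diagonal d * W - W * diagonal e) i j = -(W i j * (e j - d i)) := by
    simp [diagonal_mul, mul_diagonal]; ring
  have e2 : (diagonal (fun i => Real.exp (-d i)) * W * diagonal (fun i => Real.exp (e i)) -
      diagonal (fun i => Real.exp (d i)) * W * diagonal (fun i => Real.exp (-e i))) i j =
      W i j * (2 * Real.sinh (e j - d i)) := by
    simp only [sub_apply, diagonal_mul, mul_diagonal]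
    rw [Real.sinh_eq, show e j - d i = -d i + e j by ring, Real.exp_add,
      show -(-d i + e j) = d i + -e j by ring, Real.exp_add]
    ring
  rw [e1, e2]
  have h3 : (e j - d i) ^ 2 ≤ Real.sinh (e j - d i) ^ 2 := by
    rw [sq_le_sq, Real.abs_sinh]
    exact Real.self_le_sinh_iff.2 (abs_nonneg _)
  nlinarith [mul_le_mul_of_nonneg_left h3 (sq_nonneg (W i j))]

end Matrix

/-! ### The Lie algebra of a closed matrix group -/

namespace LinearReductive

open Filter

variable {G : Type*} [Group G] [TopologicalSpace G] {ι : Type*} [Fintype ι] [DecidableEq ι]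
variable (R : LinearReductive G ι)

theorem mat_mul (g h : G) : R.mat (g * h) = R.mat g * R.mat h := by simp [mat]

theorem mat_one : R.mat 1 = 1 := by simp [mat]

theorem isUnit_mat (g : G) : IsUnit (R.mat g) := Units.isUnit _

theorem mat_inv (g : G) : R.mat g⁻¹ = (R.mat g)⁻¹ := by simp [mat]

theorem mat_mul_mat_inv (g : G) : R.mat g * R.mat g⁻¹ = 1 := by
  rw [← mat_mul, mul_inv_cancel, mat_one]

theorem mat_inv_mul_mat (g : G) : R.mat g⁻¹ * R.mat g = 1 := by
  rw [← mat_mul, inv_mul_cancel, mat_one]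

theorem mat_zpow (g : G) (n : ℤ) : R.mat (g ^ n) = R.mat g ^ n := by
  simp [mat, Matrix.coe_units_zpow]

theorem mat_pow (g : G) (n : ℕ) : R.mat (g ^ n) = R.mat g ^ n := by
  simp [mat]

theorem isEmbedding_mat : Topology.IsEmbedding R.mat :=
  (Units.isOpenEmbedding_val (R := Matrix ι ι ℝ)).isEmbedding.comp
    R.isClosedEmbedding.isEmbedding

theorem mat_injective : Function.Injective R.mat := R.isEmbedding_mat.injective

theorem continuous_mat : Continuous R.mat := R.isEmbedding_mat.continuous

/-- The element of `G` whose matrix is the transpose. -/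
noncomputable def transpose (g : G) : G := (R.transpose_mem g).choose

theorem mat_transpose (g : G) : R.mat (R.transpose g) = (R.mat g)ᵀ :=
  (R.transpose_mem g).choose_spec

theorem exists_mat_eq_of_mem_closure {M : Matrix ι ι ℝ} (hM : M ∈ closure (Set.range R.mat))
    (hu : IsUnit M) : ∃ g, R.mat g = M := by
  obtain ⟨u, rfl⟩ := hu
  have h : u ∈ closure (Set.range R.toGL) := by
    rw [(Units.isOpenEmbedding_val (R := Matrix ι ι ℝ)).isInducing.closure_eq_preimage_closure_image,
      Set.mem_preimage, ← Set.range_comp]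
    exact hM
  rw [R.isClosedEmbedding.isClosed_range.closure_eq] at h
  obtain ⟨g, hg⟩ := h
  exact ⟨g, by rw [mat, hg]⟩

theorem exists_mat_eq_exp {X : Matrix ι ι ℝ} (hX : X ∈ R.lieAlg) :
    ∃ g, R.mat g = NormedSpace.exp X := by
  simpa using hX 1

theorem mem_lieAlg_of_tendsto {α : Type*} {l : Filter α} [NeBot l] {Y : α → Matrix ι ι ℝ}
    {s : α → ℝ} {X : Matrix ι ι ℝ} (hY : ∀ᶠ n in l, ∃ g, R.mat g = NormedSpace.exp (Y n))
    (hY0 : Tendsto Y l (𝓝 0)) (hs : Tendsto (fun n => s n • Y n) l (𝓝 X)) : X ∈ R.lieAlg := by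
  intro t
  refine R.exists_mat_eq_of_mem_closure ?_ (Matrix.isUnit_exp _)
  have hlim : Tendsto (fun n => (⌊t * s n⌋ : ℝ) • Y n) l (𝓝 (t • X)) := by
    have h1 : Tendsto (fun n => Int.fract (t * s n) • Y n) l (𝓝 0) := by
      rw [tendsto_zero_iff_norm_tendsto_zero] at hY0 ⊢
      refine squeeze_zero (fun _ => norm_nonneg _) (fun n => ?_) hY0
      rw [norm_smul, Real.norm_eq_abs, abs_of_nonneg (Int.fract_nonneg _)]
      exact mul_le_of_le_one_left (norm_nonneg _) (Int.fract_lt_one _).le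
    have h2 := (hs.const_smul t).sub h1
    rw [sub_zero] at h2
    refine h2.congr fun n => ?_
    rw [smul_smul, ← sub_smul, Int.self_sub_fract]
  refine mem_closure_of_tendsto ((NormedSpace.exp_continuous.tendsto _).comp hlim) ?_
  filter_upwards [hY] with n ⟨g, hg⟩
  refine ⟨g ^ ⌊t * s n⌋, ?_⟩
  rw [mat_zpow, hg, ← Matrix.exp_zsmul, Function.comp, Int.cast_smul_eq_zsmul]

theorem hasStrictFDerivAt_matrix_exp :
    HasStrictFDerivAt (NormedSpace.exp : Matrix ι ι ℝ → Matrix ι ι ℝ)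
      (ContinuousLinearEquiv.refl ℝ (Matrix ι ι ℝ) : Matrix ι ι ℝ →L[ℝ] Matrix ι ι ℝ) 0 :=
  hasStrictFDerivAt_exp_zero

theorem hasDerivAt_exp_zero (X : Matrix ι ι ℝ) :
    HasDerivAt (fun t : ℝ => NormedSpace.exp (t • X)) X 0 := by
  simpa using hasDerivAt_exp_smul_const X (0 : ℝ)

theorem mem_lieAlg_of_hasDerivAt {c : ℝ → Matrix ι ι ℝ} {X : Matrix ι ι ℝ}
    (hc : ∀ t, ∃ g, R.mat g = c t) (h0 : c 0 = 1) (hX : HasDerivAt c X 0) : X ∈ R.lieAlg := by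
  have hE := hasStrictFDerivAt_matrix_exp (ι := ι)
  set log := HasStrictFDerivAt.localInverse _ _ _ hE
  have hc1 : c 0 = NormedSpace.exp (0 : Matrix ι ι ℝ) := by simp [h0]
  have hlog : HasFDerivAt log ((ContinuousLinearEquiv.refl ℝ (Matrix ι ι ℝ)).symm :
      Matrix ι ι ℝ →L[ℝ] Matrix ι ι ℝ) (c 0) := by
    rw [hc1]; exact hE.to_localInverse.hasFDerivAt
  have hlog0 : log (c 0) = 0 := by rw [hc1]; exact hE.localInverse_apply_image
  have hd : HasDerivAt (log ∘ c) X 0 := hlog.comp_hasDerivAt (0 : ℝ) hX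
  have hright : ∀ᶠ M in 𝓝 (c 0), NormedSpace.exp (log M) = M := by
    rw [hc1]; exact hE.eventually_right_inverse
  refine R.mem_lieAlg_of_tendsto (l := 𝓝[≠] (0 : ℝ)) (Y := log ∘ c) (s := fun t => t⁻¹) ?_ ?_ ?_
  · refine ((hX.continuousAt.tendsto.eventually hright).filter_mono nhdsWithin_le_nhds).mono ?_
    intro t ht
    obtain ⟨g, hg⟩ := hc t
    exact ⟨g, by rw [hg, Function.comp, ht]⟩
  · have := hd.continuousAt.tendsto
    rw [Function.comp, hlog0] at this
    exact this.mono_left nhdsWithin_le_nhds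
  · have := hasDerivAt_iff_tendsto_slope.1 hd
    refine this.congr fun t => ?_
    simp [slope, hlog0]

/-- The Lie algebra as a linear subspace. -/
def lieSubmodule : Submodule ℝ (Matrix ι ι ℝ) where
  carrier := R.lieAlg
  zero_mem' := fun t => ⟨1, by simp [mat_one]⟩
  add_mem' := fun {X Y} hX hY => by
    refine R.mem_lieAlg_of_hasDerivAt
      (c := fun t => NormedSpace.exp (t • X) * NormedSpace.exp (t • Y)) (fun t => ?_) (by simp) ?_
    · obtain ⟨g, hg⟩ := hX t
      obtain ⟨h, hh⟩ := hY t
      exact ⟨g * h, by rw [mat_mul, hg, hh]⟩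
    · exact ((hasDerivAt_exp_zero X).mul (hasDerivAt_exp_zero Y)).congr_deriv (by simp)
  smul_mem' := fun r X hX t => by
    obtain ⟨g, hg⟩ := hX (t * r)
    exact ⟨g, by rw [hg, smul_smul]⟩

theorem conj_mem_lieSubmodule (g : G) {X : Matrix ι ι ℝ} (hX : X ∈ R.lieSubmodule) :
    R.mat g * X * R.mat g⁻¹ ∈ R.lieSubmodule := by
  intro t
  obtain ⟨h, hh⟩ := hX t
  refine ⟨g * h * g⁻¹, ?_⟩
  rw [mat_mul, mat_mul, hh, mat_inv, ← Matrix.exp_conj _ _ (R.isUnit_mat g)]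
  simp

theorem transpose_mem_lieSubmodule {X : Matrix ι ι ℝ} (hX : X ∈ R.lieSubmodule) :
    Xᵀ ∈ R.lieSubmodule := by
  intro t
  obtain ⟨h, hh⟩ := hX t
  refine ⟨R.transpose h, ?_⟩
  rw [mat_transpose, hh, ← Matrix.exp_transpose, Matrix.transpose_smul]

theorem hasDerivAt_conj_exp (Z X : Matrix ι ι ℝ) (t : ℝ) :
    HasDerivAt (fun t : ℝ => NormedSpace.exp (t • Z) * X * NormedSpace.exp (-(t • Z)))
      (NormedSpace.exp (t • Z) * ⁅Z, X⁆ * NormedSpace.exp (-(t • Z))) t := by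
  have h1 := (hasDerivAt_exp_smul_const Z t).mul_const X
  have h2 := hasDerivAt_exp_smul_const' (-Z) t
  have h3 := h1.mul h2
  simp only [smul_neg] at h3
  refine h3.congr_deriv ?_
  rw [Ring.lie_def]
  noncomm_ring

theorem lie_mem_lieSubmodule {X Y : Matrix ι ι ℝ} (hX : X ∈ R.lieSubmodule)
    (hY : Y ∈ R.lieSubmodule) : ⁅X, Y⁆ ∈ R.lieSubmodule := by
  have hd := hasDerivAt_conj_exp X Y 0
  simp only [zero_smul, neg_zero, NormedSpace.exp_zero, one_mul, mul_one] at hd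
  have hcl : IsClosed (R.lieSubmodule : Set (Matrix ι ι ℝ)) :=
    Submodule.closed_of_finiteDimensional _
  refine hcl.mem_of_tendsto (hasDerivAt_iff_tendsto_slope.1 hd) (Eventually.of_forall fun t => ?_)
  rw [slope, vsub_eq_sub, sub_zero]
  refine Submodule.smul_mem _ _ (Submodule.sub_mem _ ?_ ?_)
  · obtain ⟨g, hg⟩ := hX t
    have := R.conj_mem_lieSubmodule g hY
    rwa [mat_inv, hg, ← Matrix.exp_neg] at this
  · simpa using hY

end LinearReductive

/-! ### A connected closed matrix group is generated by exponentials -/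

namespace LinearReductive

open Filter

variable {G : Type*} [Group G] [TopologicalSpace G] {ι : Type*} [Fintype ι] [DecidableEq ι]
variable (R : LinearReductive G ι)

theorem hasStrictFDerivAt_exp_comp (L : Matrix ι ι ℝ →L[ℝ] Matrix ι ι ℝ) :
    HasStrictFDerivAt (fun Z => NormedSpace.exp (L Z)) L 0 := by
  have h1 : HasStrictFDerivAt (NormedSpace.exp : Matrix ι ι ℝ → Matrix ι ι ℝ)
      (1 : Matrix ι ι ℝ →L[ℝ] Matrix ι ι ℝ) (L 0) := by
    rw [map_zero]; exact hasStrictFDerivAt_exp_zero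
  exact h1.comp 0 L.hasStrictFDerivAt

theorem hasStrictFDerivAt_exp_mul_exp_mul_exp (L₁ L₂ L₃ : Matrix ι ι ℝ →L[ℝ] Matrix ι ι ℝ)
    (h : ∀ Z, L₁ Z + L₂ Z + L₃ Z = Z) :
    HasStrictFDerivAt
      (fun Z => NormedSpace.exp (L₁ Z) * NormedSpace.exp (L₂ Z) * NormedSpace.exp (L₃ Z))
      (ContinuousLinearEquiv.refl ℝ (Matrix ι ι ℝ) : Matrix ι ι ℝ →L[ℝ] Matrix ι ι ℝ) 0 := by
  refine (((hasStrictFDerivAt_exp_comp L₁).mul' (hasStrictFDerivAt_exp_comp L₂)).mul'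
    (hasStrictFDerivAt_exp_comp L₃)).congr_fderiv ?_
  refine ContinuousLinearMap.ext fun Z => ?_
  refine Eq.trans ?_ (h Z)
  simp
  abel

/-- The skew-symmetric part of a matrix. -/
noncomputable def skewPart : Matrix ι ι ℝ →L[ℝ] Matrix ι ι ℝ :=
  LinearMap.toContinuousLinearMap
    ((1 / 2 : ℝ) • (LinearMap.id - (Matrix.transposeLinearEquiv ι ι ℝ ℝ).toLinearMap))

/-- The symmetric part of a matrix. -/
noncomputable def symmPart : Matrix ι ι ℝ →L[ℝ] Matrix ι ι ℝ :=
  LinearMap.toContinuousLinearMap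
    ((1 / 2 : ℝ) • (LinearMap.id + (Matrix.transposeLinearEquiv ι ι ℝ ℝ).toLinearMap))

theorem skewPart_apply (Z : Matrix ι ι ℝ) : skewPart Z = (1 / 2 : ℝ) • (Z - Zᵀ) := rfl

theorem symmPart_apply (Z : Matrix ι ι ℝ) : symmPart Z = (1 / 2 : ℝ) • (Z + Zᵀ) := rfl

/-- Elements of `G` close to `1` are of the form `exp Z exp X` with `Z ∈ 𝔨` and `X ∈ 𝔭`. -/
theorem eventually_mat_eq_exp_mul_exp :
    ∀ᶠ g in 𝓝 (1 : G), ∃ Z ∈ R.lieSubmodule, Zᵀ = -Z ∧ ∃ X ∈ R.lieSubmodule, Xᵀ = X ∧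
      R.mat g = NormedSpace.exp Z * NormedSpace.exp X := by
  set P : Matrix ι ι ℝ →L[ℝ] Matrix ι ι ℝ := R.lieSubmodule.starProjection
  have hP : ∀ Z, P Z ∈ R.lieSubmodule := fun Z => R.lieSubmodule.starProjection_apply_mem Z
  have hQ : ∀ Z, Z - P Z ∈ R.lieSubmoduleᗮ := fun Z =>
    R.lieSubmodule.sub_starProjection_mem_orthogonal Z
  set L₁ := skewPart.comp P
  set L₂ := symmPart.comp P
  set L₃ := ContinuousLinearMap.id ℝ (Matrix ι ι ℝ) - P
  have hL₁ : ∀ Z, L₁ Z ∈ R.lieSubmodule ∧ (L₁ Z)ᵀ = - L₁ Z := fun Z => by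
    refine ⟨Submodule.smul_mem _ _ (Submodule.sub_mem _ (hP Z)
      (R.transpose_mem_lieSubmodule (hP Z))), ?_⟩
    change (skewPart (P Z))ᵀ = - skewPart (P Z)
    rw [skewPart_apply]
    simp [← smul_neg]
  have hL₂ : ∀ Z, L₂ Z ∈ R.lieSubmodule ∧ (L₂ Z)ᵀ = L₂ Z := fun Z => by
    refine ⟨Submodule.smul_mem _ _ (Submodule.add_mem _ (hP Z)
      (R.transpose_mem_lieSubmodule (hP Z))), ?_⟩
    change (symmPart (P Z))ᵀ = symmPart (P Z)
    rw [symmPart_apply]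
    simp [add_comm]
  have hsum : ∀ Z, L₁ Z + L₂ Z + L₃ Z = Z := fun Z => by
    change skewPart (P Z) + symmPart (P Z) + (Z - P Z) = Z
    rw [skewPart_apply, symmPart_apply]
    module
  have hE := hasStrictFDerivAt_exp_mul_exp_mul_exp L₁ L₂ L₃ hsum
  set ψ := HasStrictFDerivAt.localInverse _ _ _ hE
  have h1 : R.mat 1 = NormedSpace.exp (L₁ 0) * NormedSpace.exp (L₂ 0) * NormedSpace.exp (L₃ 0) := by
    simp [mat_one]
  have hright : ∀ᶠ g in 𝓝 (1 : G), NormedSpace.exp (L₁ (ψ (R.mat g))) *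
      NormedSpace.exp (L₂ (ψ (R.mat g))) * NormedSpace.exp (L₃ (ψ (R.mat g))) = R.mat g := by
    have : ∀ᶠ M in 𝓝 (R.mat 1), NormedSpace.exp (L₁ (ψ M)) *
      NormedSpace.exp (L₂ (ψ M)) * NormedSpace.exp (L₃ (ψ M)) = M := by
      rw [h1]; exact hE.eventually_right_inverse
    exact R.continuous_mat.continuousAt.eventually this
  have hψ : Tendsto (fun g => ψ (R.mat g)) (𝓝 1) (𝓝 0) := by
    have h2 : Tendsto ψ (𝓝 (R.mat 1)) (𝓝 0) := by
      have h3 : ψ (R.mat 1) = 0 := by rw [h1]; exact hE.localInverse_apply_image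
      have h4 : ContinuousAt ψ (R.mat 1) := by rw [h1]; exact hE.localInverse_continuousAt
      simpa [ContinuousAt, h3] using h4
    exact h2.comp R.continuous_mat.continuousAt
  suffices h : ∀ᶠ g in 𝓝 (1 : G), L₃ (ψ (R.mat g)) = 0 by
    filter_upwards [hright, h] with g hg h3
    refine ⟨_, (hL₁ (ψ (R.mat g))).1, (hL₁ _).2, _, (hL₂ (ψ (R.mat g))).1, (hL₂ _).2, ?_⟩
    rw [h3, NormedSpace.exp_zero, mul_one] at hg
    exact hg.symm
  by_contra hcon
  set l : Filter G := 𝓝 1 ⊓ 𝓟 {g | L₃ (ψ (R.mat g)) ≠ 0}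
  have hl : NeBot l := by
    rw [← frequently_mem_iff_neBot]
    exact not_eventually.1 hcon
  set N : G → Matrix ι ι ℝ := fun g => L₃ (ψ (R.mat g))
  have hN0 : Tendsto N l (𝓝 0) := by
    have : Tendsto N (𝓝 1) (𝓝 (L₃ 0)) := (L₃.continuous.tendsto _).comp hψ
    rw [map_zero] at this
    exact this.mono_left inf_le_left
  have hNexp : ∀ᶠ g in l, ∃ h, R.mat h = NormedSpace.exp (N g) := by
    refine (hright.filter_mono inf_le_left).mono fun g hg => ?_
    obtain ⟨a, ha⟩ := R.exists_mat_eq_exp (hL₁ (ψ (R.mat g))).1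
    obtain ⟨b, hb⟩ := R.exists_mat_eq_exp (hL₂ (ψ (R.mat g))).1
    refine ⟨(a * b)⁻¹ * g, ?_⟩
    have h2 : R.mat g = R.mat (a * b) * NormedSpace.exp (N g) := by
      rw [mat_mul, ha, hb]; exact hg.symm
    rw [mat_mul, h2, ← mul_assoc, mat_inv_mul_mat, one_mul]
  have hne : ∀ᶠ g in l, N g ≠ 0 := eventually_inf_principal.2 (Eventually.of_forall fun _ h => h)
  have hsph : ∀ᶠ g in l, ‖N g‖⁻¹ • N g ∈ Metric.sphere (0 : Matrix ι ι ℝ) 1 := by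
    filter_upwards [hne] with g hg
    simp [norm_smul, norm_ne_zero_iff.2 hg]
  obtain ⟨u, hu, hcl⟩ := (isCompact_sphere (0 : Matrix ι ι ℝ) 1).exists_mapClusterPt
    (tendsto_principal.2 hsph)
  obtain ⟨l', hl'l, hl'ne, hlim⟩ : ∃ l' ≤ l, NeBot l' ∧
      Tendsto (fun g => ‖N g‖⁻¹ • N g) l' (𝓝 u) :=
    ⟨l ⊓ comap (fun g => ‖N g‖⁻¹ • N g) (𝓝 u), inf_le_left,
      by
        rw [MapClusterPt, ClusterPt] at hcl
        rw [← map_neBot_iff (fun g => ‖N g‖⁻¹ • N g), Filter.push_pull, inf_comm]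
        exact hcl,
      tendsto_comap.mono_left inf_le_right⟩
  have hu1 : u ∈ R.lieSubmodule :=
    R.mem_lieAlg_of_tendsto (l := l') (hNexp.filter_mono hl'l) (hN0.mono_left hl'l) hlim
  have hu2 : u ∈ R.lieSubmoduleᗮ := by
    have hcl : IsClosed (R.lieSubmoduleᗮ : Set (Matrix ι ι ℝ)) :=
      Submodule.closed_of_finiteDimensional _
    exact hcl.mem_of_tendsto hlim (Eventually.of_forall fun g => Submodule.smul_mem _ _ (hQ _))
  have hu0 : u = 0 := by
    have := R.lieSubmodule.inf_orthogonal_eq_bot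
    exact (Submodule.mem_bot ℝ).1 (this ▸ Submodule.mem_inf.2 ⟨hu1, hu2⟩)
  simp [hu0] at hu

/-- A connected closed matrix group is generated by `exp 𝔨` and `exp 𝔭`. -/
theorem subgroup_eq_top [IsTopologicalGroup G] [ConnectedSpace G] (Q : Subgroup G)
    (hQ : ∀ g, ∀ X ∈ R.lieSubmodule, (Xᵀ = -X ∨ Xᵀ = X) → R.mat g = NormedSpace.exp X → g ∈ Q) :
    Q = ⊤ := by
  have hmem : (Q : Set G) ∈ 𝓝 (1 : G) := by
    filter_upwards [R.eventually_mat_eq_exp_mul_exp] with g ⟨Z, hZ, hZt, X, hX, hXt, hg⟩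
    obtain ⟨a, ha⟩ := R.exists_mat_eq_exp hZ
    obtain ⟨b, hb⟩ := R.exists_mat_eq_exp hX
    have : g = a * b := R.mat_injective (by rw [hg, mat_mul, ha, hb])
    rw [this]
    exact Q.mul_mem (hQ a Z hZ (Or.inl hZt) ha) (hQ b X hX (Or.inr hXt) hb)
  have hopen : IsOpen (Q : Set G) := Q.isOpen_of_mem_nhds hmem
  have hclopen : IsClopen (Q : Set G) := ⟨Q.isClosed_of_isOpen hopen, hopen⟩
  have := hclopen.eq_univ ⟨1, Q.one_mem⟩
  exact SetLike.coe_injective (by simpa using this)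

end LinearReductive

/-! ### Polar decomposition -/

namespace Matrix

variable {ι : Type*} [Fintype ι] [DecidableEq ι]

/-- Entrywise multiplication by `f` in the orthonormal basis given by `U`. -/
def entrywiseMul (U : Matrix ι ι ℝ) (f : ι → ι → ℝ) (Y : Matrix ι ι ℝ) : Matrix ι ι ℝ :=
  U * of (fun i j => f i j * (Uᵀ * Y * U) i j) * Uᵀ

theorem entrywiseMul_add (U : Matrix ι ι ℝ) (f g : ι → ι → ℝ) (Y : Matrix ι ι ℝ) :
    entrywiseMul U (fun i j => f i j + g i j) Y = entrywiseMul U f Y + entrywiseMul U g Y := by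
  rw [entrywiseMul, entrywiseMul, entrywiseMul, ← add_mul, ← mul_add]
  congr 2
  ext i j
  simp [add_mul]

theorem entrywiseMul_smul (U : Matrix ι ι ℝ) (c : ℝ) (f : ι → ι → ℝ) (Y : Matrix ι ι ℝ) :
    entrywiseMul U (fun i j => c * f i j) Y = c • entrywiseMul U f Y := by
  rw [entrywiseMul, entrywiseMul, ← Matrix.smul_mul, ← Matrix.mul_smul]
  congr 2
  ext i j
  simp [mul_assoc]

theorem entrywiseMul_one {U : Matrix ι ι ℝ} (hU : U ∈ orthogonalGroup ι ℝ) (Y : Matrix ι ι ℝ) :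
    entrywiseMul U (fun _ _ => 1) Y = Y := by
  have : (of fun i j => 1 * (Uᵀ * Y * U) i j) = Uᵀ * Y * U := by ext; simp
  rw [entrywiseMul, this]
  calc U * (Uᵀ * Y * U) * Uᵀ = (U * Uᵀ) * Y * (U * Uᵀ) := by simp only [mul_assoc]
    _ = Y := by rw [orthogonal_mul_transpose hU]; simp

theorem entrywiseMul_diagonal {U : Matrix ι ι ℝ} (hU : U ∈ orthogonalGroup ι ℝ) (p q : ι → ℝ)
    (f : ι → ι → ℝ) (Y : Matrix ι ι ℝ) :
    (U * diagonal p * Uᵀ) * entrywiseMul U f Y * (U * diagonal q * Uᵀ) =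
      entrywiseMul U (fun i j => p i * f i j * q j) Y := by
  rw [entrywiseMul, entrywiseMul]
  calc _ = U * (diagonal p * ((Uᵀ * U) * of (fun i j => f i j * (Uᵀ * Y * U) i j) * (Uᵀ * U)) *
        diagonal q) * Uᵀ := by simp only [mul_assoc]
    _ = _ := by
      rw [orthogonal_transpose_mul hU, one_mul, mul_one]
      congr 2
      ext i j
      simp only [diagonal_mul, mul_diagonal, of_apply]
      ring

/-- If a subspace is stable under conjugation by `exp X`, with `X` symmetric, then it is stable
under `ad X`. -/
theorem lie_mem_of_exp_conj_mem {V : Submodule ℝ (Matrix ι ι ℝ)} {X : Matrix ι ι ℝ} (hX : Xᵀ = X)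
    (hV : ∀ Y ∈ V, NormedSpace.exp X * Y * NormedSpace.exp (-X) ∈ V) {Y : Matrix ι ι ℝ}
    (hY : Y ∈ V) : ⁅X, Y⁆ ∈ V := by
  obtain ⟨U, hU, d, rfl⟩ := exists_orthogonal_diagonal hX
  have hneg : -(U * diagonal d * Uᵀ) = U * diagonal (fun i => - d i) * Uᵀ := by
    have : diagonal (fun i => - d i) = - diagonal d := by simp [← diagonal_neg]
    simp only [this, mul_neg, neg_mul]
  rw [hneg, exp_orthogonal_diagonal hU, exp_orthogonal_diagonal hU] at hV
  have hpow : ∀ n : ℕ, entrywiseMul U (fun i j => Real.exp (d i - d j) ^ n) Y ∈ V := by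
    intro n
    induction n with
    | zero => simpa [entrywiseMul_one hU] using hY
    | succ n ih =>
      have := hV _ ih
      rw [entrywiseMul_diagonal hU] at this
      convert this using 4 with i j
      rw [sub_eq_add_neg, Real.exp_add]
      ring
  have hpoly : ∀ p : Polynomial ℝ,
      entrywiseMul U (fun i j => p.eval (Real.exp (d i - d j))) Y ∈ V := by
    intro p
    induction p using Polynomial.induction_on' with
    | add p q hp hq =>
      simp only [Polynomial.eval_add, entrywiseMul_add]
      exact V.add_mem hp hq
    | monomial n a =>
      simp only [Polynomial.eval_monomial, entrywiseMul_smul]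
      exact V.smul_mem _ (hpow n)
  set s : Finset ℝ := Finset.univ.image (fun ij : ι × ι => Real.exp (d ij.1 - d ij.2))
  have h := hpoly (Lagrange.interpolate s id Real.log)
  have hlog : ∀ i j, (Lagrange.interpolate s id Real.log).eval (Real.exp (d i - d j)) =
      d i * 1 * 1 + (-1) * (1 * 1 * d j) := fun i j => by
    have hm : Real.exp (d i - d j) ∈ s := Finset.mem_image_of_mem
      (fun ij : ι × ι => Real.exp (d ij.1 - d ij.2)) (Finset.mem_univ (i, j))
    have := Lagrange.eval_interpolate_at_node (s := s) (v := id) Real.log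
      (Set.injOn_id _) hm
    rw [id, Real.log_exp] at this
    rw [this]
    ring
  simp only [hlog] at h
  rw [entrywiseMul_add, entrywiseMul_smul,
    ← entrywiseMul_diagonal hU d (fun _ => 1) (fun _ _ => 1),
    ← entrywiseMul_diagonal hU (fun _ => 1) d (fun _ _ => 1), entrywiseMul_one hU,
    diagonal_one, mul_one, orthogonal_mul_transpose hU, mul_one, one_mul] at h
  rw [Ring.lie_def]
  simpa [sub_eq_add_neg] using h

theorem commute_diagonal_comp {U A : Matrix ι ι ℝ} (hU : U ∈ orthogonalGroup ι ℝ) {z : ι → ℝ}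
    (h : Commute A (U * diagonal z * Uᵀ)) (f : ℝ → ℝ) :
    Commute A (U * diagonal (fun i => f (z i)) * Uᵀ) := by
  have h1 : ∀ w : ι → ℝ, Commute A (U * diagonal w * Uᵀ) ↔
      (Uᵀ * A * U) * diagonal w = diagonal w * (Uᵀ * A * U) := by
    intro w
    have e1 : Uᵀ * (A * (U * diagonal w * Uᵀ)) * U = (Uᵀ * A * U) * diagonal w := by
      calc _ = Uᵀ * A * U * diagonal w * (Uᵀ * U) := by simp only [mul_assoc]
        _ = _ := by rw [orthogonal_transpose_mul hU, mul_one]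
    have e2 : Uᵀ * ((U * diagonal w * Uᵀ) * A) * U = diagonal w * (Uᵀ * A * U) := by
      calc _ = (Uᵀ * U) * diagonal w * (Uᵀ * A * U) := by simp only [mul_assoc]
        _ = _ := by rw [orthogonal_transpose_mul hU, one_mul]
    rw [← e1, ← e2]
    constructor
    · intro h; rw [h.eq]
    · intro h
      have h2 := congrArg (fun M => U * M * Uᵀ) h
      have e3 : ∀ M, U * (Uᵀ * M * U) * Uᵀ = M := fun M => by
        calc _ = (U * Uᵀ) * M * (U * Uᵀ) := by simp only [mul_assoc]
          _ = M := by rw [orthogonal_mul_transpose hU]; simp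
      simp only [e3] at h2
      exact h2
  rw [h1] at h ⊢
  ext i j
  have hij := congrFun (congrFun h i) j
  simp only [diagonal_mul, mul_diagonal] at hij ⊢
  rcases eq_or_ne ((Uᵀ * A * U) i j) 0 with h0 | h0
  · simp [h0]
  · have : z j = z i := by
      rw [mul_comm] at hij
      exact mul_right_cancel₀ h0 hij
    rw [this, mul_comm]

theorem mul_exp_eq_of_mul_eq_zero {p N : Matrix ι ι ℝ} (h : p * N = 0) :
    p * NormedSpace.exp N = p := by
  have h1 := (NormedSpace.exp_series_hasSum_exp' (𝕂 := ℝ) N).mul_left p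
  have h2 : HasSum (fun n : ℕ => p * ((n.factorial : ℝ)⁻¹ • N ^ n))
      (p * (((0 : ℕ).factorial : ℝ)⁻¹ • N ^ 0)) := by
    refine hasSum_single 0 fun n hn => ?_
    obtain ⟨m, rfl⟩ := Nat.exists_eq_succ_of_ne_zero hn
    rw [mul_smul_comm, pow_succ', ← mul_assoc, h, zero_mul, smul_zero]
  simpa using h1.unique h2

theorem mul_exp_add_one_sub {p X : Matrix ι ι ℝ} (hp : p * p = p) (h : Commute p X) :
    p * NormedSpace.exp X + (1 - p) = NormedSpace.exp (p * X) := by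
  have hc : Commute (p * X) ((1 - p) * X) := by
    have h2 : Commute p ((1 - p) * X) :=
      ((Commute.one_right p).sub_right (Commute.refl p)).mul_right h
    have h3 : Commute X ((1 - p) * X) :=
      ((Commute.one_right X).sub_right h.symm).mul_right (Commute.refl X)
    exact h2.mul_left h3
  have hX : X = p * X + (1 - p) * X := by rw [← add_mul]; simp
  have e1 : NormedSpace.exp X = NormedSpace.exp ((1 - p) * X) * NormedSpace.exp (p * X) := by
    conv_lhs => rw [hX, exp_add_of_commute _ _ hc]
    exact hc.exp.eq
  have z1 : p * ((1 - p) * X) = 0 := by rw [← mul_assoc, mul_sub, mul_one, hp, sub_self, zero_mul]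
  have z2 : (1 - p) * (p * X) = 0 := by rw [← mul_assoc, sub_mul, one_mul, hp, sub_self, zero_mul]
  rw [e1, ← mul_assoc, mul_exp_eq_of_mul_eq_zero z1]
  have e2 := mul_exp_eq_of_mul_eq_zero z2
  rw [sub_mul, one_mul, sub_eq_iff_eq_add] at e2
  rw [add_comm]
  exact e2.symm

theorem log_abs_det_exp {S : Matrix ι ι ℝ} (hS : Sᵀ = -S ∨ Sᵀ = S) :
    Real.log |(NormedSpace.exp S).det| = S.trace := by
  rcases hS with h | h
  · have ht : S.trace = 0 := by
      have := trace_transpose S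
      rw [h, trace_neg] at this
      linarith
    have ho : (NormedSpace.exp S)ᵀ * NormedSpace.exp S = 1 := by
      rw [← exp_transpose, h, exp_neg, nonsing_inv_mul _ ((isUnit_iff_isUnit_det _).1 (isUnit_exp S))]
    have hd := congrArg det ho
    rw [det_mul, det_transpose, det_one, ← sq, ← sq_abs, pow_eq_one_iff_of_nonneg (abs_nonneg _) two_ne_zero] at hd
    rw [hd, ht, Real.log_one]
  · obtain ⟨U, hU, d, rfl⟩ := exists_orthogonal_diagonal h
    have e1 : (U * diagonal d * Uᵀ).trace = ∑ i, d i := by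
      rw [trace_mul_comm, ← mul_assoc, orthogonal_transpose_mul hU, one_mul, trace_diagonal]
    have e2 : (U * diagonal (fun i => Real.exp (d i)) * Uᵀ).det = Real.exp (∑ i, d i) := by
      rw [det_mul_comm, ← mul_assoc, orthogonal_transpose_mul hU, one_mul, det_diagonal,
        Real.exp_sum]
    rw [exp_orthogonal_diagonal hU, e1, e2, abs_of_pos (Real.exp_pos _), Real.log_exp]

theorem trace_mul_self_transpose_eq_zero {A : Matrix ι ι ℝ} (h : (Aᵀ * A).trace = 0) : A = 0 := by
  rw [← MatrixFrobenius.norm_sq_eq_trace] at h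
  simpa using h

theorem trace_lie_mul (A B C : Matrix ι ι ℝ) : (⁅A, B⁆ * C).trace = (A * ⁅B, C⁆).trace := by
  rw [Ring.lie_def, Ring.lie_def, sub_mul, mul_sub, trace_sub, trace_sub, mul_assoc, mul_assoc,
    trace_mul_comm B (A * C), mul_assoc]

end Matrix

namespace LinearReductive

open Matrix

variable {G : Type*} [Group G] [TopologicalSpace G] {ι : Type*} [Fintype ι] [DecidableEq ι]
variable (R : LinearReductive G ι)

theorem log_abs_det_block_mul {p : Matrix ι ι ℝ} (hp : p * p = p)
    (hc : ∀ g, Commute (R.mat g) p) (g h : G) :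
    Real.log |(p * R.mat (g * h) + (1 - p)).det| =
      Real.log |(p * R.mat g + (1 - p)).det| + Real.log |(p * R.mat h + (1 - p)).det| := by
  have hmul : ∀ a b : G, (p * R.mat a + (1 - p)) * (p * R.mat b + (1 - p)) =
      p * R.mat (a * b) + (1 - p) := by
    intro a b
    have h1 : p * R.mat a * (p * R.mat b) = p * (R.mat a * R.mat b) := by
      rw [← mul_assoc, mul_assoc p, (hc a).eq, ← mul_assoc p p, hp, mul_assoc]
    have h2 : p * R.mat a * (1 - p) = 0 := by
      rw [mul_sub, mul_one, mul_assoc, (hc a).eq, ← mul_assoc, hp, sub_self]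
    have h3 : (1 - p) * (p * R.mat b) = 0 := by
      rw [← mul_assoc, sub_mul, one_mul, hp, sub_self, zero_mul]
    have h4 : (1 - p) * (1 - p) = 1 - p := by
      rw [mul_sub, mul_one, sub_mul, one_mul, hp, sub_self, sub_zero]
    rw [mat_mul, add_mul, mul_add, mul_add, h1, h2, h3, h4]
    simp
  have hne : ∀ a : G, (p * R.mat a + (1 - p)).det ≠ 0 := fun a h0 => by
    have := congrArg det (hmul a a⁻¹)
    rw [det_mul, h0, zero_mul, mul_inv_cancel, mat_one, mul_one] at this
    simp at this
  rw [← hmul, det_mul, abs_mul, Real.log_mul (abs_ne_zero.2 (hne g)) (abs_ne_zero.2 (hne h))]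

theorem commute_mat_of_commute_lie [IsTopologicalGroup G] [ConnectedSpace G] {C : Matrix ι ι ℝ}
    (hC : ∀ Y ∈ R.lieSubmodule, Commute C Y) (g : G) : Commute C (R.mat g) := by
  let Q : Subgroup G :=
    { carrier := {g | Commute C (R.mat g)}
      mul_mem' := fun {a b} ha hb => by
        rw [Set.mem_ofPred_eq, mat_mul]; exact Commute.mul_right ha hb
      one_mem' := by rw [Set.mem_ofPred_eq, mat_one]; exact Commute.one_right _
      inv_mem' := fun {a} ha => by
        have ha' : Commute C (R.mat a) := ha
        change C * R.mat a⁻¹ = R.mat a⁻¹ * C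
        calc C * R.mat a⁻¹ = R.mat a⁻¹ * (R.mat a * C) * R.mat a⁻¹ := by
              rw [← mul_assoc, mat_inv_mul_mat, one_mul]
          _ = R.mat a⁻¹ * C * (R.mat a * R.mat a⁻¹) := by
              rw [← ha'.eq]; simp only [mul_assoc]
          _ = R.mat a⁻¹ * C := by rw [mat_mul_mat_inv, mul_one] }
  have : Q = ⊤ := R.subgroup_eq_top Q fun g X hX _ hg => by
    change Commute C (R.mat g)
    rw [hg]
    exact (hC X hX).exp_right
  have hg : g ∈ Q := this ▸ Subgroup.mem_top g
  exact hg

/-- A symmetric matrix commuting with `G` and orthogonal to `𝔤` is orthogonal to the symmetric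
logarithms of elements of `G` with which it commutes. -/
theorem trace_mul_log_eq_zero [IsTopologicalGroup G] [ConnectedSpace G] {C X : Matrix ι ι ℝ}
    (hCt : Cᵀ = C) (hC : ∀ g, Commute (R.mat g) C)
    (horth : ∀ Y ∈ R.lieSubmodule, (C * Y).trace = 0) (hX : Xᵀ = X) (hCX : Commute X C) {g : G}
    (hg : R.mat g = NormedSpace.exp X) : (C * X).trace = 0 := by
  obtain ⟨U, hU, z, rfl⟩ := exists_orthogonal_diagonal hCt
  set p : ℝ → Matrix ι ι ℝ := fun c => U * diagonal (fun i => if z i = c then 1 else 0) * Uᵀ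
  have hpp : ∀ c, p c * p c = p c := fun c => by
    calc p c * p c = U * diagonal (fun i => if z i = c then 1 else 0) * (Uᵀ * U) *
          diagonal (fun i => if z i = c then 1 else 0) * Uᵀ := by simp only [p, mul_assoc]
      _ = p c := by
        rw [orthogonal_transpose_mul hU, mul_one, mul_assoc U, diagonal_mul_diagonal]
        change _ = U * diagonal _ * Uᵀ
        congr 3
        funext i
        split_ifs <;> simp
  have hpt : ∀ c, (p c)ᵀ = p c := fun c => by simp [p, mul_assoc]
  have hcomm : ∀ A c, Commute A (U * diagonal z * Uᵀ) → Commute A (p c) := fun A c h =>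
    commute_diagonal_comp hU h (fun x => if x = c then 1 else 0)
  set s : Finset ℝ := Finset.univ.image z
  have hsum : ∀ Y : Matrix ι ι ℝ,
      ∑ c ∈ s, c * (p c * Y).trace = (U * diagonal z * Uᵀ * Y).trace := fun Y => by
    have h1 : ∑ c ∈ s, c • p c = U * diagonal z * Uᵀ := by
      have h2 : ∑ c ∈ s, c • (diagonal (fun i => if z i = c then 1 else 0) : Matrix ι ι ℝ) =
          diagonal z := by
        ext i j
        rw [Matrix.sum_apply]
        rcases eq_or_ne i j with rfl | hij
        · simp [s]
        · simp [hij]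
      rw [← h2, Finset.mul_sum, Finset.sum_mul]
      simp [p]
    rw [← h1, Finset.sum_mul, trace_sum]
    simp
  set ℓ : G → ℝ := fun g => ∑ c ∈ s, c * Real.log |(p c * R.mat g + (1 - p c)).det|
  have hmul : ∀ a b, ℓ (a * b) = ℓ a + ℓ b := fun a b => by
    simp only [ℓ, ← Finset.sum_add_distrib, ← mul_add]
    exact Finset.sum_congr rfl fun c _ => by
      rw [R.log_abs_det_block_mul (hpp c) (fun g => hcomm _ c (hC g))]
  have hexp : ∀ (Y : Matrix ι ι ℝ) (a : G), (Yᵀ = -Y ∨ Yᵀ = Y) →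
      Commute Y (U * diagonal z * Uᵀ) → R.mat a = NormedSpace.exp Y →
      ℓ a = (U * diagonal z * Uᵀ * Y).trace := fun Y a hY hYC ha => by
    rw [← hsum]
    refine Finset.sum_congr rfl fun c _ => ?_
    have hcY := hcomm Y c hYC
    rw [ha, mul_exp_add_one_sub (hpp c) hcY.symm, log_abs_det_exp]
    rcases hY with h | h
    · left; rw [transpose_mul, hpt, h, neg_mul, hcY.eq]
    · right; rw [transpose_mul, hpt, h, hcY.eq]
  have hone : ℓ 1 = 0 := by
    have := hmul 1 1
    rw [mul_one] at this
    linarith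
  let Q : Subgroup G :=
    { carrier := {g | ℓ g = 0}
      mul_mem' := fun {a b} ha hb => by
        rw [Set.mem_ofPred_eq] at *; rw [hmul, ha, hb, add_zero]
      one_mem' := hone
      inv_mem' := fun {a} ha => by
        rw [Set.mem_ofPred_eq] at *
        have := hmul a a⁻¹
        rw [mul_inv_cancel, hone, ha, zero_add] at this
        exact this.symm }
  have hcommlie : ∀ Y ∈ R.lieSubmodule, Commute Y (U * diagonal z * Uᵀ) := fun Y hY => by
    have h0 := hasDerivAt_exp_zero Y
    have h1 := (h0.mul_const (U * diagonal z * Uᵀ)).unique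
      (((h0.const_mul (U * diagonal z * Uᵀ))).congr_of_eventuallyEq
        (Filter.Eventually.of_forall fun t => ?_))
    · exact h1
    · obtain ⟨a, ha⟩ := hY t
      change NormedSpace.exp (t • Y) * (U * diagonal z * Uᵀ) =
        (U * diagonal z * Uᵀ) * NormedSpace.exp (t • Y)
      rw [← ha]
      exact hC a
  have hQ : Q = ⊤ := R.subgroup_eq_top Q fun a Y hY hYt ha => by
    change ℓ a = 0
    rw [hexp Y a hYt (hcommlie Y hY) ha, horth Y hY]
  have hgQ : g ∈ Q := hQ ▸ Subgroup.mem_top g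
  rw [← hexp X g (Or.inr hX) hCX hg]
  exact hgQ

/-- If `exp X ∈ G` with `X` symmetric, then `X ∈ 𝔤`. -/
theorem mem_lieAlg_of_exp_mem [IsTopologicalGroup G] [ConnectedSpace G] {X : Matrix ι ι ℝ}
    (hX : Xᵀ = X) {g : G} (hg : R.mat g = NormedSpace.exp X) : X ∈ R.lieAlg := by
  have hlie : ∀ Y ∈ R.lieSubmodule, ⁅X, Y⁆ ∈ R.lieSubmodule := fun Y hY =>
    lie_mem_of_exp_conj_mem hX (fun Z hZ => by
      have := R.conj_mem_lieSubmodule g hZ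
      rwa [mat_inv, hg, ← Matrix.exp_neg] at this) hY
  set X₁ := R.lieSubmodule.starProjection X
  have hX₁ : X₁ ∈ R.lieSubmodule := R.lieSubmodule.starProjection_apply_mem X
  have hX₂ : X - X₁ ∈ R.lieSubmoduleᗮ := R.lieSubmodule.sub_starProjection_mem_orthogonal X
  set C := X - X₁
  have hX₁t : X₁ᵀ = X₁ := by
    refine (Submodule.eq_starProjection_of_mem_of_inner_eq_zero
      (R.transpose_mem_lieSubmodule hX₁) fun W hW => ?_).symm
    have h1 := (Submodule.mem_orthogonal' _ _).1 hX₂ _ (R.transpose_mem_lieSubmodule hW)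
    rw [MatrixFrobenius.inner_def] at h1 ⊢
    rw [← h1, ← trace_transpose, transpose_mul, transpose_transpose, ← trace_mul_comm]
    simp [C, hX]
  have hCt : Cᵀ = C := by simp [C, hX, hX₁t]
  have horth : ∀ Y ∈ R.lieSubmodule, (C * Y).trace = 0 := fun Y hY => by
    have := (Submodule.mem_orthogonal' _ _).1 hX₂ Y hY
    rwa [MatrixFrobenius.inner_def, hCt] at this
  have hClie : ∀ Y ∈ R.lieSubmodule, Commute C Y := fun Y hY => by
    have h1 : ⁅C, Y⁆ ∈ R.lieSubmodule := by
      rw [show ⁅C, Y⁆ = ⁅X, Y⁆ - ⁅X₁, Y⁆ by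
        simp only [Ring.lie_def, C]; noncomm_ring]
      exact Submodule.sub_mem _ (hlie Y hY) (R.lie_mem_lieSubmodule hX₁ hY)
    have h2 : (⁅C, Y⁆ᵀ * ⁅C, Y⁆).trace = 0 := by
      rw [trace_mul_comm, trace_lie_mul]
      exact horth _ (R.lie_mem_lieSubmodule hY (R.transpose_mem_lieSubmodule h1))
    exact (commute_iff_lie_eq).2 (trace_mul_self_transpose_eq_zero h2)
  have hCX : Commute X C := by
    have h1 := (hClie X₁ hX₁).symm
    have : X = X₁ + C := by simp [C]
    rw [this]
    exact h1.add_left (Commute.refl _)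
  have h0 := R.trace_mul_log_eq_zero hCt (fun g => (R.commute_mat_of_commute_lie hClie g).symm)
    horth hX hCX hg
  have hC0 : C = 0 := by
    refine trace_mul_self_transpose_eq_zero ?_
    have h1 := horth X₁ hX₁
    have h2 : C * C = C * X - C * X₁ := by rw [← mul_sub]
    rw [hCt, h2, trace_sub, h0, h1, sub_zero]
  have : X = X₁ := sub_eq_zero.1 hC0
  rw [this]
  exact hX₁

/-- Polar decomposition `G = K exp 𝔭`. -/
theorem exists_polar [IsTopologicalGroup G] [ConnectedSpace G] (g : G) :
    ∃ k ∈ R.maximalCompact, ∃ X ∈ R.lieP, R.mat g = R.mat k * NormedSpace.exp X := by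
  obtain ⟨X, hXt, hX⟩ := exists_symm_exp_eq (R.isUnit_mat g)
  have hg : R.mat (R.transpose g * g) = NormedSpace.exp X := by rw [mat_mul, mat_transpose, hX]
  have hXl : X ∈ R.lieSubmodule := R.mem_lieAlg_of_exp_mem hXt hg
  have hXl2 : (1 / 2 : ℝ) • X ∈ R.lieSubmodule := Submodule.smul_mem _ _ hXl
  have hXt2 : ((1 / 2 : ℝ) • X)ᵀ = (1 / 2 : ℝ) • X := by rw [transpose_smul, hXt]
  obtain ⟨a, ha⟩ := R.exists_mat_eq_exp hXl2
  have haa : NormedSpace.exp X = R.mat a * R.mat a := by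
    rw [ha, ← Matrix.exp_add_of_commute _ _ (Commute.refl _), ← add_smul]
    norm_num
  have hat : (R.mat a)ᵀ = R.mat a := by rw [ha, ← Matrix.exp_transpose, hXt2]
  refine ⟨g * a⁻¹, ?_, (1 / 2 : ℝ) • X, ⟨hXl2, hXt2⟩, ?_⟩
  · change R.mat (g * a⁻¹) ∈ orthogonalGroup ι ℝ
    rw [mem_orthogonalGroup_iff']
    have hat' : (R.mat a⁻¹)ᵀ = R.mat a⁻¹ := by rw [mat_inv, transpose_nonsing_inv, hat]
    change (R.mat (g * a⁻¹))ᵀ * R.mat (g * a⁻¹) = 1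
    rw [mat_mul, transpose_mul, hat', mul_assoc, ← mul_assoc _ (R.mat g), ← hX, haa, mul_assoc,
      mat_mul_mat_inv, mul_one, mat_inv_mul_mat]
  · rw [← ha, ← mat_mul, inv_mul_cancel_right]

end LinearReductive

/-! ### Conjugating `𝔭` into the Weyl chamber -/

namespace LinearReductive

open Matrix

variable {G : Type*} [Group G] [TopologicalSpace G] {ι : Type*} [Fintype ι] [DecidableEq ι]
variable (R : LinearReductive G ι)

theorem isCompact_setOf_norm_le (r : ℝ) :
    IsCompact {g : G | ‖R.mat g‖ ≤ r ∧ ‖R.mat g⁻¹‖ ≤ r} := by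
  have h1 : Topology.IsClosedEmbedding (fun g : G => Units.embedProduct (Matrix ι ι ℝ) (R.toGL g)) :=
    Units.isClosedEmbedding_embedProduct.comp R.isClosedEmbedding
  have h2 : IsCompact (Metric.closedBall (0 : Matrix ι ι ℝ) r ×ˢ
      (MulOpposite.opHomeomorph '' Metric.closedBall (0 : Matrix ι ι ℝ) r)) :=
    (isCompact_closedBall 0 r).prod
      ((isCompact_closedBall 0 r).image MulOpposite.opHomeomorph.continuous)
  convert h1.isCompact_preimage h2 using 1
  ext g
  simp only [Set.mem_preimage, Set.mem_prod]
  have h3 : (Units.embedProduct (Matrix ι ι ℝ) (R.toGL g)).2 =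
      MulOpposite.opHomeomorph (R.mat g⁻¹) := by simp [mat]
  have h4 : (Units.embedProduct (Matrix ι ι ℝ) (R.toGL g)).1 = R.mat g := by simp [mat]
  rw [h3, h4, MulOpposite.opHomeomorph.injective.mem_set_image]
  simp

theorem one_mem_maximalCompact : (1 : G) ∈ R.maximalCompact := by
  change R.mat 1 ∈ orthogonalGroup ι ℝ
  rw [mat_one]; exact one_mem _

theorem mul_mem_maximalCompact {k l : G} (hk : k ∈ R.maximalCompact) (hl : l ∈ R.maximalCompact) :
    k * l ∈ R.maximalCompact := by
  change R.mat _ ∈ orthogonalGroup ι ℝ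
  rw [mat_mul]; exact mul_mem hk hl

theorem mat_inv_eq_transpose {k : G} (hk : k ∈ R.maximalCompact) : R.mat k⁻¹ = (R.mat k)ᵀ := by
  rw [mat_inv, orthogonal_inv hk]

theorem inv_mem_maximalCompact {k : G} (hk : k ∈ R.maximalCompact) : k⁻¹ ∈ R.maximalCompact := by
  change R.mat _ ∈ orthogonalGroup ι ℝ
  rw [R.mat_inv_eq_transpose hk]; exact orthogonal_transpose_mem hk

theorem isCompact_maximalCompact [IsTopologicalGroup G] : IsCompact R.maximalCompact := by
  refine (R.isCompact_setOf_norm_le ‖(1 : Matrix ι ι ℝ)‖).of_isClosed_subset ?_ ?_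
  · have : R.maximalCompact = {g | (R.mat g)ᵀ * R.mat g = 1} := by
      ext g
      exact mem_orthogonalGroup_iff' ι ℝ
    rw [this]
    exact isClosed_eq (by have := R.continuous_mat; fun_prop) continuous_const
  · have h : ∀ k ∈ R.maximalCompact, ‖R.mat k‖ = ‖(1 : Matrix ι ι ℝ)‖ := fun k hk => by
      rw [← mul_one (R.mat k), norm_orthogonal_mul hk]
    exact fun k hk => ⟨(h k hk).le, (h _ (R.inv_mem_maximalCompact hk)).le⟩

theorem conj_mem_lieP {k : G} (hk : k ∈ R.maximalCompact) {X : Matrix ι ι ℝ} (hX : X ∈ R.lieP) :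
    R.mat k * X * R.mat k⁻¹ ∈ R.lieP := by
  refine ⟨R.conj_mem_lieSubmodule k hX.1, ?_⟩
  rw [R.mat_inv_eq_transpose hk]
  simp only [transpose_mul, transpose_transpose, hX.2, mul_assoc]

theorem exp_mem_maximalCompact {Z : Matrix ι ι ℝ} (hZ : Z ∈ R.lieSubmodule) (hZt : Zᵀ = -Z) :
    ∃ k ∈ R.maximalCompact, R.mat k = NormedSpace.exp Z := by
  obtain ⟨k, hk⟩ := R.exists_mat_eq_exp hZ
  refine ⟨k, ?_, hk⟩
  change R.mat k ∈ orthogonalGroup ι ℝ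
  rw [mem_orthogonalGroup_iff']
  change (R.mat k)ᵀ * R.mat k = 1
  rw [hk, ← Matrix.exp_transpose, hZt, Matrix.exp_neg,
    nonsing_inv_mul _ ((isUnit_iff_isUnit_det _).1 (isUnit_exp Z))]

theorem lie_lieP_skew {X A : Matrix ι ι ℝ} (hX : Xᵀ = X) (hA : Aᵀ = A) : ⁅X, A⁆ᵀ = -⁅X, A⁆ := by
  rw [Ring.lie_def, transpose_sub, transpose_mul, transpose_mul, hX, hA, neg_sub]

theorem hasDerivAt_trace_conj (Z X A : Matrix ι ι ℝ) (t : ℝ) :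
    HasDerivAt
      (fun t : ℝ => (NormedSpace.exp (t • Z) * X * NormedSpace.exp (-(t • Z)) * A).trace)
      (NormedSpace.exp (t • Z) * ⁅Z, X⁆ * NormedSpace.exp (-(t • Z)) * A).trace t := by
  let T : Matrix ι ι ℝ →L[ℝ] ℝ := LinearMap.toContinuousLinearMap
    ((traceLinearMap ι ℝ ℝ).comp (LinearMap.mulRight ℝ A))
  exact T.hasFDerivAt.comp_hasDerivAt t (hasDerivAt_conj_exp Z X t)

/-- The conjugate of `X ∈ 𝔭` by `K` that is best aligned with `A ∈ 𝔭` commutes with `A`, and the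
second variation of the alignment is nonpositive. -/
theorem exists_aligned [IsTopologicalGroup G] {X A : Matrix ι ι ℝ} (hX : X ∈ R.lieP)
    (hA : A ∈ R.lieP) :
    ∃ k ∈ R.maximalCompact, ⁅R.mat k * X * R.mat k⁻¹, A⁆ = 0 ∧
      (∀ l ∈ R.maximalCompact, (R.mat l * X * R.mat l⁻¹ * A).trace ≤
        (R.mat k * X * R.mat k⁻¹ * A).trace) ∧
      ∀ Z ∈ R.lieSubmodule, Zᵀ = -Z → (⁅Z, ⁅Z, R.mat k * X * R.mat k⁻¹⁆⁆ * A).trace ≤ 0 := by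
  have hcont : Continuous fun l : G => (R.mat l * X * R.mat l⁻¹ * A).trace := by
    have h1 := R.continuous_mat
    have h2 : Continuous fun l : G => R.mat l⁻¹ := h1.comp continuous_inv
    fun_prop
  obtain ⟨k, hk, hmax⟩ := R.isCompact_maximalCompact.exists_isMaxOn
    ⟨1, R.one_mem_maximalCompact⟩ hcont.continuousOn
  set X' := R.mat k * X * R.mat k⁻¹
  have hX' : X' ∈ R.lieP := R.conj_mem_lieP hk hX
  have hle : ∀ Z ∈ R.lieSubmodule, Zᵀ = -Z → ∀ t : ℝ,
      (NormedSpace.exp (t • Z) * X' * NormedSpace.exp (-(t • Z)) * A).trace ≤ (X' * A).trace := by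
    intro Z hZ hZt t
    obtain ⟨l, hl, hlm⟩ := R.exp_mem_maximalCompact (Submodule.smul_mem _ t hZ)
      (by rw [transpose_smul, hZt, smul_neg])
    have := isMaxOn_iff.1 hmax (l * k) (R.mul_mem_maximalCompact hl hk)
    rw [_root_.mul_inv_rev, mat_mul, mat_mul, R.mat_inv l, hlm, ← Matrix.exp_neg] at this
    simpa only [X', mul_assoc] using this
  have hmaxloc : ∀ Z ∈ R.lieSubmodule, Zᵀ = -Z → IsLocalMax
      (fun t : ℝ => (NormedSpace.exp (t • Z) * X' * NormedSpace.exp (-(t • Z)) * A).trace) 0 := by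
    intro Z hZ hZt
    refine Filter.Eventually.of_forall fun t => ?_
    simpa using hle Z hZ hZt t
  refine ⟨k, hk, ?_, fun l hl => isMaxOn_iff.1 hmax l hl, fun Z hZ hZt => ?_⟩
  · have hZ : ⁅X', A⁆ ∈ R.lieSubmodule := R.lie_mem_lieSubmodule hX'.1 hA.1
    have hZt : ⁅X', A⁆ᵀ = -⁅X', A⁆ := lie_lieP_skew hX'.2 hA.2
    have h0 := (hmaxloc _ hZ hZt).hasDerivAt_eq_zero (hasDerivAt_trace_conj _ X' A 0)
    simp only [zero_smul, neg_zero, NormedSpace.exp_zero, one_mul, mul_one] at h0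
    rw [trace_lie_mul] at h0
    refine trace_mul_self_transpose_eq_zero ?_
    rw [hZt, neg_mul, trace_neg, h0, neg_zero]
  · by_contra! hpos
    have hd1 : deriv (fun t : ℝ =>
        (NormedSpace.exp (t • Z) * X' * NormedSpace.exp (-(t • Z)) * A).trace) = fun t : ℝ =>
        (NormedSpace.exp (t • Z) * ⁅Z, X'⁆ * NormedSpace.exp (-(t • Z)) * A).trace :=
      funext fun t => (hasDerivAt_trace_conj Z X' A t).deriv
    have hd2 := hasDerivAt_trace_conj Z ⁅Z, X'⁆ A 0
    have hmin : IsLocalMin (fun t : ℝ =>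
        (NormedSpace.exp (t • Z) * X' * NormedSpace.exp (-(t • Z)) * A).trace) 0 := by
      refine isLocalMin_of_deriv_deriv_pos ?_ ?_ (hasDerivAt_trace_conj Z X' A 0).continuousAt
      · rw [hd1, hd2.deriv]
        simpa using hpos
      · exact (hmaxloc Z hZ hZt).deriv_eq_zero
    have heq : (fun t : ℝ =>
        (NormedSpace.exp (t • Z) * X' * NormedSpace.exp (-(t • Z)) * A).trace) =ᶠ[𝓝 0]
        fun _ => (X' * A).trace := by
      filter_upwards [hmin] with t ht
      refine le_antisymm (hle Z hZ hZt t) ?_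
      simpa using ht
    have h1 := heq.deriv.deriv_eq
    rw [hd1, hd2.deriv] at h1
    simp only [zero_smul, neg_zero, NormedSpace.exp_zero, one_mul, mul_one, deriv_const'] at h1
    rw [h1] at hpos
    simp at hpos

end LinearReductive

/-! ### Existence of Cartan components -/

namespace LinearReductive

open Matrix

variable {G : Type*} [Group G] [TopologicalSpace G] {ι : Type*} [Fintype ι] [DecidableEq ι]
variable {R : LinearReductive G ι} {𝔞 : Submodule ℝ (Matrix ι ι ℝ)} {Δ : Set (Module.Dual ℝ 𝔞)}

/-- The adjoint action of a matrix. -/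
def adLinear (A : Matrix ι ι ℝ) : Matrix ι ι ℝ →ₗ[ℝ] Matrix ι ι ℝ :=
  LinearMap.mulLeft ℝ A - LinearMap.mulRight ℝ A

theorem adLinear_apply (A Y : Matrix ι ι ℝ) : adLinear A Y = ⁅A, Y⁆ := by
  simp [adLinear, Ring.lie_def]

theorem adLinear_comm {A B : Matrix ι ι ℝ} (h : ⁅A, B⁆ = 0) (Y : Matrix ι ι ℝ) :
    adLinear A (adLinear B Y) = adLinear B (adLinear A Y) := by
  have h' : A * B = B * A := by rwa [Ring.lie_def, sub_eq_zero] at h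
  simp only [adLinear_apply, Ring.lie_def]
  have : A * (B * Y - Y * B) - (B * Y - Y * B) * A - (B * (A * Y - Y * A) - (A * Y - Y * A) * B) =
      (A * B - B * A) * Y - Y * (A * B - B * A) := by noncomm_ring
  rw [← sub_eq_zero, this, h']
  simp

theorem inner_adLinear {A : Matrix ι ι ℝ} (hA : Aᵀ = A) (Y Z : Matrix ι ι ℝ) :
    inner ℝ (adLinear A Y) Z = inner ℝ Y (adLinear A Z) := by
  rw [MatrixFrobenius.inner_def, MatrixFrobenius.inner_def, adLinear_apply, adLinear_apply,
    ← trace_lie_mul, Ring.lie_def, Ring.lie_def, transpose_sub, transpose_mul, transpose_mul, hA]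

/-- Commuting symmetric operators on a nonzero subspace have a common eigenvector. -/
theorem exists_common_eigenvector {κ : Type*} {A : κ → Matrix ι ι ℝ} (hA : ∀ i, (A i)ᵀ = A i)
    (hcomm : ∀ i j, ⁅A i, A j⁆ = 0) {W : Submodule ℝ (Matrix ι ι ℝ)} (hW : W ≠ ⊥)
    (hstable : ∀ i, ∀ w ∈ W, adLinear (A i) w ∈ W) :
    ∃ v ∈ W, v ≠ 0 ∧ ∃ χ : κ → ℝ, ∀ i, ⁅A i, v⁆ = χ i • v := by
  let T : κ → W →ₗ[ℝ] W := fun i => (adLinear (A i)).restrict (hstable i)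
  have hT : ∀ i, (T i).IsSymmetric := fun i x y => inner_adLinear (hA i) x y
  have hc : Pairwise (Function.onFun Commute T) := fun i j _ =>
    LinearMap.ext fun w => Subtype.ext (adLinear_comm (hcomm i j) w)
  have htop := LinearMap.IsSymmetric.iSup_iInf_eq_top_of_commute hT hc
  have hne : ∃ χ : κ → ℝ, (⨅ i, Module.End.eigenspace (T i) (χ i)) ≠ ⊥ := by
    by_contra! h
    rw [iSup_eq_bot.2 h] at htop
    have : Nontrivial W := Submodule.nontrivial_iff_ne_bot.2 hW
    exact bot_ne_top htop
  obtain ⟨χ, hχ⟩ := hne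
  obtain ⟨v, hv, hv0⟩ := Submodule.exists_mem_ne_zero_of_ne_bot hχ
  refine ⟨v, v.2, fun h => hv0 (Subtype.ext h), χ, fun i => ?_⟩
  have h1 := (Submodule.mem_iInf _).1 hv i
  rw [Module.End.mem_eigenspace_iff] at h1
  have := congrArg Subtype.val h1
  rw [← adLinear_apply]
  exact this

/-- A matrix in `𝔤` commuting with an element of `𝔞` on which no restricted root vanishes commutes
with `𝔞`. -/
theorem lie_eq_zero_of_regular (h𝔞 : R.IsAbelianInP 𝔞) {H₀ : 𝔞}
    (hH₀ : ∀ α ∈ R.restrictedRoots 𝔞, α H₀ ≠ 0) {X : Matrix ι ι ℝ} (hX : X ∈ R.lieSubmodule)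
    (hXH : ⁅(H₀ : Matrix ι ι ℝ), X⁆ = 0) (a₀ : 𝔞) : ⁅(a₀ : Matrix ι ι ℝ), X⁆ = 0 := by
  by_contra hne
  have hsymm : ∀ a : 𝔞, (a : Matrix ι ι ℝ)ᵀ = a := fun a => (h𝔞.1 a.2).2
  have hab : ∀ a b : 𝔞, ⁅(a : Matrix ι ι ℝ), (b : Matrix ι ι ℝ)⁆ = 0 := fun a b =>
    h𝔞.2 a a.2 b b.2
  let V : Submodule ℝ (Matrix ι ι ℝ) :=
    R.lieSubmodule ⊓ LinearMap.ker (adLinear (H₀ : Matrix ι ι ℝ))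
  have hV : ∀ a : 𝔞, ∀ Y ∈ V, adLinear (a : Matrix ι ι ℝ) Y ∈ V := fun a Y hY => by
    refine ⟨?_, ?_⟩
    · rw [adLinear_apply]
      exact R.lie_mem_lieSubmodule (h𝔞.1 a.2).1 hY.1
    · have : adLinear (H₀ : Matrix ι ι ℝ) Y = 0 := hY.2
      change adLinear (H₀ : Matrix ι ι ℝ) (adLinear (a : Matrix ι ι ℝ) Y) = 0
      rw [adLinear_comm (hab H₀ a), this, map_zero]
  let W : Submodule ℝ (Matrix ι ι ℝ) := V.map (adLinear (a₀ : Matrix ι ι ℝ))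
  have hWV : W ≤ V := by
    rintro _ ⟨Y, hY, rfl⟩
    exact hV a₀ Y hY
  have hXV : X ∈ V := ⟨hX, (adLinear_apply _ _).trans hXH⟩
  have hWne : W ≠ ⊥ := fun h => by
    have : adLinear (a₀ : Matrix ι ι ℝ) X ∈ W := ⟨X, hXV, rfl⟩
    rw [h, Submodule.mem_bot, adLinear_apply] at this
    exact hne this
  obtain ⟨v, hvW, hv0, χ, hχ⟩ := exists_common_eigenvector (A := fun a : 𝔞 => (a : Matrix ι ι ℝ))
    hsymm hab hWne (fun a w hw => by
      obtain ⟨Y, hY, rfl⟩ := hw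
      exact ⟨adLinear (a : Matrix ι ι ℝ) Y, hV a Y hY, adLinear_comm (hab a₀ a) Y⟩)
  have hinj : ∀ r s : ℝ, r • v = s • v → r = s := fun r s h => smul_left_injective ℝ hv0 h
  let α : Module.Dual ℝ 𝔞 :=
    { toFun := χ
      map_add' := fun a b => hinj _ _ (by
        rw [add_smul, ← hχ, ← hχ, ← hχ, Submodule.coe_add, Ring.lie_def, Ring.lie_def,
          Ring.lie_def]
        noncomm_ring)
      map_smul' := fun r a => hinj _ _ (by
        rw [RingHom.id_apply, smul_eq_mul, mul_smul, ← hχ, ← hχ, Submodule.coe_smul,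
          Ring.lie_def, Ring.lie_def, smul_sub, smul_mul_assoc, mul_smul_comm]) }
  have hαa₀ : α a₀ ≠ 0 := fun h0 => by
    obtain ⟨Y, _, hY⟩ := hvW
    have h1 : adLinear (a₀ : Matrix ι ι ℝ) v = 0 := by
      rw [adLinear_apply, hχ]
      change α a₀ • v = 0
      rw [h0, zero_smul]
    refine hv0 (inner_self_eq_zero (𝕜 := ℝ).1 ?_)
    nth_rewrite 1 [← hY]
    rw [inner_adLinear (hsymm a₀), h1, inner_zero_right]
  have hαH₀ : α H₀ = 0 := by
    have h1 : adLinear (H₀ : Matrix ι ι ℝ) v = 0 := (hWV hvW).2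
    rw [adLinear_apply, hχ] at h1
    exact (smul_eq_zero.1 h1).resolve_right hv0
  exact hH₀ α ⟨fun h => hαa₀ (by rw [h]; rfl), v, (hWV hvW).1, hv0, hχ⟩ hαH₀

theorem exists_forall_simple_pos (hΔ : R.IsSimpleSystem 𝔞 Δ) : ∃ H₀ : 𝔞, ∀ α ∈ Δ, 0 < α H₀ := by
  let b := Module.Basis.extend hΔ.linearIndependent.linearIndepOn_id
  let f : Module.Dual ℝ (Module.Dual ℝ 𝔞) := b.constr ℝ fun _ => (1 : ℝ)
  obtain ⟨H₀, hH₀⟩ := (Module.evalEquiv ℝ 𝔞).surjective f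
  refine ⟨H₀, fun α hα => ?_⟩
  have h1 : f α = 1 := by
    have hmem : α ∈ hΔ.linearIndependent.linearIndepOn_id.extend (Set.subset_univ _) :=
      LinearIndepOn.subset_extend _ _ ⟨⟨α, hα⟩, rfl⟩
    have hb : b ⟨α, hmem⟩ = α := Module.Basis.extend_apply_self _ _
    rw [← hb]
    simp [f]
  have h2 : f α = α H₀ := by rw [← hH₀]; rfl
  rw [← h2, h1]
  exact one_pos

theorem restrictedRoot_ne_zero (hΔ : R.IsSimpleSystem 𝔞 Δ) {H₀ : 𝔞} (hH₀ : ∀ α ∈ Δ, 0 < α H₀)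
    {α : Module.Dual ℝ 𝔞} (hα : α ∈ R.restrictedRoots 𝔞) : α H₀ ≠ 0 := by
  have hspan : ∀ β ∈ Submodule.span ℝ≥0 Δ, β = 0 ∨ 0 < β H₀ := by
    intro β hβ
    induction hβ using Submodule.span_induction with
    | mem x hx => exact Or.inr (hH₀ x hx)
    | zero => exact Or.inl rfl
    | add x y _ _ hx hy =>
      rcases hx with rfl | hx
      · simpa using hy
      · rcases hy with rfl | hy
        · right; simpa using hx
        · right; rw [LinearMap.add_apply]; exact add_pos hx hy
    | smul c x _ hx =>
      rcases hx with rfl | hx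
      · left; simp
      · rcases eq_or_ne c 0 with rfl | hc
        · left; simp
        · right
          change 0 < (c : ℝ) * x H₀
          exact mul_pos (NNReal.coe_pos.2 (pos_iff_ne_zero.2 hc)) hx
  rcases hΔ.pos_or_neg α hα with h | h
  · rcases hspan α h with h0 | h0
    · exact absurd h0 hα.1
    · exact h0.ne'
  · rcases hspan _ h with h0 | h0
    · exact absurd (neg_eq_zero.1 h0) hα.1
    · intro h1
      rw [LinearMap.neg_apply, h1, neg_zero] at h0
      exact lt_irrefl _ h0

theorem mem_of_lie_eq_zero (h𝔞 : R.IsCartanSubspace 𝔞) {X : Matrix ι ι ℝ} (hX : X ∈ R.lieP)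
    (hcomm : ∀ a ∈ 𝔞, ⁅a, X⁆ = 0) : X ∈ 𝔞 := by
  have hc : ∀ a ∈ 𝔞, Commute a X := fun a ha => by
    have := hcomm a ha
    rwa [Ring.lie_def, sub_eq_zero] at this
  have h1 : R.IsAbelianInP (𝔞 ⊔ Submodule.span ℝ {X}) := by
    refine ⟨fun Y hY => ?_, fun Y hY Y' hY' => ?_⟩
    · obtain ⟨a, ha, x, hx, rfl⟩ := Submodule.mem_sup.1 hY
      obtain ⟨r, rfl⟩ := Submodule.mem_span_singleton.1 hx
      refine ⟨R.lieSubmodule.add_mem (h𝔞.1.1 ha).1 (R.lieSubmodule.smul_mem r hX.1), ?_⟩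
      rw [transpose_add, transpose_smul, hX.2, (h𝔞.1.1 ha).2]
    · obtain ⟨a, ha, x, hx, rfl⟩ := Submodule.mem_sup.1 hY
      obtain ⟨r, rfl⟩ := Submodule.mem_span_singleton.1 hx
      obtain ⟨a', ha', x', hx', rfl⟩ := Submodule.mem_sup.1 hY'
      obtain ⟨r', rfl⟩ := Submodule.mem_span_singleton.1 hx'
      have haa : Commute a a' := by
        have := h𝔞.1.2 a ha a' ha'
        rwa [Ring.lie_def, sub_eq_zero] at this
      have : Commute (a + r • X) (a' + r' • X) :=
        (haa.add_right ((hc a ha).smul_right r')).add_left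
          (((hc a' ha').symm.smul_left r).add_right
            (((Commute.refl X).smul_left r).smul_right r'))
      rw [Ring.lie_def, this.eq, sub_self]
  exact h𝔞.2 h1 le_sup_left (Submodule.mem_sup_right (Submodule.mem_span_singleton_self X))

/-- Every element of `𝔭` is conjugate under `K` to an element of the Weyl chamber. -/
theorem exists_conj_mem_weylChamber [IsTopologicalGroup G] (h𝔞 : R.IsCartanSubspace 𝔞)
    (hΔ : R.IsSimpleSystem 𝔞 Δ) {X : Matrix ι ι ℝ} (hX : X ∈ R.lieP) :
    ∃ k ∈ R.maximalCompact, ∃ a ∈ weylChamber 𝔞 Δ,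
      (a : Matrix ι ι ℝ) = R.mat k * X * R.mat k⁻¹ := by
  obtain ⟨H₀, hH₀⟩ := exists_forall_simple_pos hΔ
  have hA : (H₀ : Matrix ι ι ℝ) ∈ R.lieP := h𝔞.1.1 H₀.2
  obtain ⟨k, hk, hlie, -, hsecond⟩ := R.exists_aligned hX hA
  set X' := R.mat k * X * R.mat k⁻¹
  have hX' : X' ∈ R.lieP := R.conj_mem_lieP hk hX
  have hlie' : ⁅(H₀ : Matrix ι ι ℝ), X'⁆ = 0 := by
    rw [Ring.lie_def, sub_eq_zero] at hlie ⊢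
    exact hlie.symm
  have hmem : X' ∈ 𝔞 := mem_of_lie_eq_zero h𝔞 hX' fun a ha =>
    lie_eq_zero_of_regular h𝔞.1 (fun α hα => restrictedRoot_ne_zero hΔ hH₀ hα) hX'.1 hlie' ⟨a, ha⟩
  refine ⟨k, hk, ⟨X', hmem⟩, fun α hα => ?_, rfl⟩
  obtain ⟨-, E, hE, hE0, hroot⟩ := hΔ.subset hα
  have hE' : E ∈ R.lieSubmodule := hE
  have hpos := hH₀ α hα
  have hrootT : ∀ a : 𝔞, ⁅(a : Matrix ι ι ℝ), Eᵀ⁆ = -(α a • Eᵀ) := fun a => by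
    have h1 := congrArg Matrix.transpose (hroot a)
    rw [Ring.lie_def, transpose_sub, transpose_mul, transpose_mul, (h𝔞.1.1 a.2).2,
      transpose_smul] at h1
    rw [Ring.lie_def, ← h1, neg_sub]
  set F := E + Eᵀ
  set Z := E - Eᵀ
  have hFt : Fᵀ = F := by simp [F, add_comm]
  have hZt : Zᵀ = -Z := by simp [Z]
  have hZ : Z ∈ R.lieSubmodule :=
    Submodule.sub_mem _ hE' (R.transpose_mem_lieSubmodule hE')
  have hZa : ∀ a : 𝔞, ⁅Z, (a : Matrix ι ι ℝ)⁆ = -(α a • F) := fun a => by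
    have h1 : ⁅Z, (a : Matrix ι ι ℝ)⁆ =
        -⁅(a : Matrix ι ι ℝ), E⁆ + ⁅(a : Matrix ι ι ℝ), Eᵀ⁆ := by
      simp only [Ring.lie_def, Z]; noncomm_ring
    rw [h1, hroot, hrootT, smul_add, neg_add]
  have hF0 : F ≠ 0 := fun h => by
    have h1 : Eᵀ = -E := eq_neg_of_add_eq_zero_right h
    have h2 := hrootT H₀
    have h3 : ⁅(H₀ : Matrix ι ι ℝ), -E⁆ = -⁅(H₀ : Matrix ι ι ℝ), E⁆ := by
      simp only [Ring.lie_def]; noncomm_ring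
    rw [h1, h3, hroot, smul_neg, neg_neg, neg_eq_iff_add_eq_zero, ← add_smul] at h2
    rcases smul_eq_zero.1 h2 with h4 | h4
    · linarith
    · exact hE0 h4
  have h2 := hsecond Z hZ hZt
  have h3 : ⁅Z, X'⁆ = -(α ⟨X', hmem⟩ • F) := hZa ⟨X', hmem⟩
  have h4 : ⁅Z, ⁅Z, X'⁆⁆ = α ⟨X', hmem⟩ • ⁅F, Z⁆ := by
    rw [h3, Ring.lie_def, Ring.lie_def, mul_neg, neg_mul, mul_smul_comm, smul_mul_assoc, smul_sub]
    abel
  rw [h4, smul_mul_assoc, trace_smul, trace_lie_mul, hZa, mul_neg, mul_smul_comm, trace_neg,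
    trace_smul, smul_eq_mul, smul_eq_mul] at h2
  have h5 : (F * F).trace = ‖F‖ ^ 2 := by rw [MatrixFrobenius.norm_sq_eq_trace, hFt]
  have h6 : 0 < α H₀ * (F * F).trace := by
    rw [h5]; have := norm_pos_iff.2 hF0; positivity
  by_contra! hneg
  nlinarith

/-- Cartan decomposition `G = K exp(𝔞⁺) K`. -/
theorem exists_isCartanComponent [IsTopologicalGroup G] [ConnectedSpace G]
    (h𝔞 : R.IsCartanSubspace 𝔞) (hΔ : R.IsSimpleSystem 𝔞 Δ) (g : G) :
    ∃ a : 𝔞, R.IsCartanComponent 𝔞 Δ g a := by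
  obtain ⟨k, hk, X, hX, hg⟩ := R.exists_polar g
  obtain ⟨l, hl, a, ha, hal⟩ := exists_conj_mem_weylChamber h𝔞 hΔ hX
  refine ⟨a, ha, k * l⁻¹, R.mul_mem_maximalCompact hk (R.inv_mem_maximalCompact hl), l, hl, ?_⟩
  rw [hal, R.mat_inv_eq_transpose hl, exp_orthogonal_conj hl, hg, mat_mul,
    R.mat_inv_eq_transpose hl]
  have h1 := orthogonal_transpose_mul hl
  calc R.mat k * NormedSpace.exp X
      = R.mat k * ((R.mat l)ᵀ * R.mat l) * NormedSpace.exp X * ((R.mat l)ᵀ * R.mat l) := by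
        rw [h1, mul_one, mul_one]
    _ = _ := by simp only [mul_assoc]

theorem isCartanComponent_cartanProjection [IsTopologicalGroup G] [ConnectedSpace G]
    (h𝔞 : R.IsCartanSubspace 𝔞) (hΔ : R.IsSimpleSystem 𝔞 Δ) (g : G) :
    R.IsCartanComponent 𝔞 Δ g (R.cartanProjection 𝔞 Δ g) := by
  have h := exists_isCartanComponent h𝔞 hΔ g
  rw [cartanProjection, dif_pos h]
  exact h.choose_spec

end LinearReductive

/-! ### Lipschitz properties of polar components -/

namespace LinearReductive

open Matrix

variable {G : Type*} [Group G] [TopologicalSpace G] {ι : Type*} [Fintype ι] [DecidableEq ι]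
variable {R : LinearReductive G ι}

/-- `x ∈ 𝔭` is a polar component of `g` if `g ∈ K exp(x) K`. -/
def IsPolar (R : LinearReductive G ι) (g : G) (x : Matrix ι ι ℝ) : Prop :=
  x ∈ R.lieP ∧ ∃ k ∈ R.maximalCompact, ∃ k' ∈ R.maximalCompact,
    R.mat g = R.mat k * NormedSpace.exp x * R.mat k'

theorem exists_isPolar [IsTopologicalGroup G] [ConnectedSpace G] (g : G) : ∃ x, R.IsPolar g x := by
  obtain ⟨k, hk, X, hX, hg⟩ := R.exists_polar g
  exact ⟨X, hX, k, hk, 1, R.one_mem_maximalCompact, by rw [hg, mat_one, mul_one]⟩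

theorem transpose_mem_maximalCompact {k : G} (hk : k ∈ R.maximalCompact) :
    R.transpose k ∈ R.maximalCompact := by
  change R.mat _ ∈ orthogonalGroup ι ℝ
  rw [mat_transpose]
  exact orthogonal_transpose_mem hk

theorem transpose_mul' (g h : G) : R.transpose (g * h) = R.transpose h * R.transpose g :=
  R.mat_injective (by simp only [mat_transpose, mat_mul, Matrix.transpose_mul])

theorem IsPolar.transpose {g : G} {x : Matrix ι ι ℝ} (h : R.IsPolar g x) :
    R.IsPolar (R.transpose g) x := by
  obtain ⟨hx, k, hk, k', hk', hg⟩ := h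
  refine ⟨hx, _, transpose_mem_maximalCompact hk', _, transpose_mem_maximalCompact hk, ?_⟩
  rw [mat_transpose, mat_transpose, mat_transpose, hg, Matrix.transpose_mul, Matrix.transpose_mul,
    ← Matrix.exp_transpose, hx.2, mul_assoc]

theorem inv_transpose_polar {A B x : Matrix ι ι ℝ} (hA : A ∈ orthogonalGroup ι ℝ)
    (hB : B ∈ orthogonalGroup ι ℝ) (hx : xᵀ = x) :
    ((A * NormedSpace.exp x * B)⁻¹)ᵀ = A * NormedSpace.exp (-x) * B := by
  rw [Matrix.mul_inv_rev, Matrix.mul_inv_rev, orthogonal_inv hA, orthogonal_inv hB,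
    ← Matrix.exp_neg, Matrix.transpose_mul, Matrix.transpose_mul, transpose_transpose,
    transpose_transpose, ← Matrix.exp_transpose, transpose_neg, hx]

theorem norm_sub_inv_transpose {A B x : Matrix ι ι ℝ} (hA : A ∈ orthogonalGroup ι ℝ)
    (hB : B ∈ orthogonalGroup ι ℝ) (hx : xᵀ = x) :
    ‖A * NormedSpace.exp x * B - ((A * NormedSpace.exp x * B)⁻¹)ᵀ‖ =
      ‖NormedSpace.exp x - NormedSpace.exp (-x)‖ := by
  rw [inv_transpose_polar hA hB hx, ← sub_mul, ← mul_sub, norm_mul_orthogonal hB,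
    norm_orthogonal_mul hA]

theorem IsPolar.two_mul_norm_le {g : G} {x : Matrix ι ι ℝ} (h : R.IsPolar g x) :
    2 * ‖x‖ ≤ ‖R.mat g - (R.mat g⁻¹)ᵀ‖ := by
  obtain ⟨hx, k, hk, k', hk', hg⟩ := h
  rw [mat_inv, hg, norm_sub_inv_transpose hk hk' hx.2]
  have := norm_intertwine_le (x := 0) (y := x) (k := 1) (by simp) hx.2
  simpa using this

/-- Conjugation by an element of `K` preserves the norm. -/
theorem norm_conj {k : G} (hk : k ∈ R.maximalCompact) (A : Matrix ι ι ℝ) :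
    ‖R.mat k * A * R.mat k⁻¹‖ = ‖A‖ := by
  rw [norm_mul_orthogonal (R.inv_mem_maximalCompact hk), norm_orthogonal_mul hk]

theorem conj_conj (k l : G) (A : Matrix ι ι ℝ) :
    R.mat k * (R.mat l * A * R.mat l⁻¹) * R.mat k⁻¹ = R.mat (k * l) * A * R.mat (k * l)⁻¹ := by
  rw [_root_.mul_inv_rev, mat_mul, mat_mul]
  simp only [mul_assoc]

theorem IsPolar.exists_conj_sub_le_sinh {g g' : G} {x y v : Matrix ι ι ℝ} (hg : R.IsPolar g x)
    (hgg' : R.IsPolar (g * g') y) (hg' : R.IsPolar g' v) :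
    ∃ k ∈ R.maximalCompact, ‖x - R.mat k * y * R.mat k⁻¹‖ ≤
      1 / 2 * ‖NormedSpace.exp v - NormedSpace.exp (-v)‖ := by
  obtain ⟨hx, k₁, hk₁, k₂, hk₂, hg⟩ := hg
  obtain ⟨hy, l₁, hl₁, l₂, hl₂, hgg'⟩ := hgg'
  obtain ⟨hv, m₁, hm₁, m₂, hm₂, hg'⟩ := hg'
  have hk : k₁⁻¹ * l₁ ∈ R.maximalCompact :=
    R.mul_mem_maximalCompact (R.inv_mem_maximalCompact hk₁) hl₁
  have hA : k₂ * m₁ ∈ R.maximalCompact := R.mul_mem_maximalCompact hk₂ hm₁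
  have hB : m₂ * l₂⁻¹ ∈ R.maximalCompact :=
    R.mul_mem_maximalCompact hm₂ (R.inv_mem_maximalCompact hl₂)
  refine ⟨k₁⁻¹ * l₁, hk, ?_⟩
  obtain ⟨ex, hex⟩ := R.exists_mat_eq_exp hx.1
  obtain ⟨ey, hey⟩ := R.exists_mat_eq_exp hy.1
  obtain ⟨ev, hev⟩ := R.exists_mat_eq_exp hv.1
  have e1 : g = k₁ * ex * k₂ := R.mat_injective (by rw [hg, mat_mul, mat_mul, hex])
  have e2 : g * g' = l₁ * ey * l₂ := R.mat_injective (by rw [hgg', mat_mul, mat_mul, hey])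
  have e3 : g' = m₁ * ev * m₂ := R.mat_injective (by rw [hg', mat_mul, mat_mul, hev])
  have hM : ex⁻¹ * (k₁⁻¹ * l₁) * ey = k₂ * m₁ * ev * (m₂ * l₂⁻¹) := by
    have h1 : k₁ * ex * k₂ * (m₁ * ev * m₂) = l₁ * ey * l₂ := by rw [← e1, ← e3, e2]
    have h2 : l₁ * ey = k₁ * ex * k₂ * (m₁ * ev * m₂) * l₂⁻¹ := by rw [h1]; group
    calc ex⁻¹ * (k₁⁻¹ * l₁) * ey = ex⁻¹ * k₁⁻¹ * (l₁ * ey) := by group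
      _ = _ := by rw [h2]; group
  have hM1 : NormedSpace.exp (-x) * R.mat (k₁⁻¹ * l₁) * NormedSpace.exp y =
      R.mat (k₂ * m₁) * NormedSpace.exp v * R.mat (m₂ * l₂⁻¹) := by
    have := congrArg R.mat hM
    rw [mat_mul, mat_mul, mat_mul _ _ (m₂ * l₂⁻¹), mat_mul _ (k₂ * m₁) ev, R.mat_inv ex, hex, hey,
      hev, ← Matrix.exp_neg] at this
    exact this
  have hM2 : NormedSpace.exp x * R.mat (k₁⁻¹ * l₁) * NormedSpace.exp (-y) =
      R.mat (k₂ * m₁) * NormedSpace.exp (-v) * R.mat (m₂ * l₂⁻¹) := by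
    rw [← inv_transpose_polar hA hB hv.2, ← hM1, Matrix.mul_inv_rev, Matrix.mul_inv_rev,
      orthogonal_inv hk, ← Matrix.exp_neg, ← Matrix.exp_neg, Matrix.transpose_mul,
      Matrix.transpose_mul, transpose_transpose, ← Matrix.exp_transpose, ← Matrix.exp_transpose,
      transpose_neg, transpose_neg, transpose_neg, neg_neg, hx.2, hy.2]
  have h := norm_intertwine_le (k := R.mat (k₁⁻¹ * l₁)) hx.2 hy.2
  rw [hM1, hM2, ← sub_mul, ← mul_sub, norm_mul_orthogonal hB, norm_orthogonal_mul hA] at h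
  have h2 : ‖x * R.mat (k₁⁻¹ * l₁) - R.mat (k₁⁻¹ * l₁) * y‖ =
      ‖x - R.mat (k₁⁻¹ * l₁) * y * R.mat (k₁⁻¹ * l₁)⁻¹‖ := by
    rw [← norm_mul_orthogonal hk (x - _), sub_mul, mul_assoc _ (R.mat (k₁⁻¹ * l₁)⁻¹),
      mat_inv_mul_mat, mul_one]
  rw [h2] at h
  linarith

theorem conj_sub_le_add {k l : G} (hk : k ∈ R.maximalCompact) {x y z : Matrix ι ι ℝ} {r s : ℝ} (h₁ : ‖x - R.mat k * y * R.mat k⁻¹‖ ≤ r)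
    (h₂ : ‖y - R.mat l * z * R.mat l⁻¹‖ ≤ s) :
    ‖x - R.mat (k * l) * z * R.mat (k * l)⁻¹‖ ≤ r + s := by
  rw [← conj_conj]
  have e : x - R.mat k * (R.mat l * z * R.mat l⁻¹) * R.mat k⁻¹ =
      (x - R.mat k * y * R.mat k⁻¹) +
        R.mat k * (y - R.mat l * z * R.mat l⁻¹) * R.mat k⁻¹ := by
    rw [mul_sub, sub_mul]; abel
  rw [e]
  refine (norm_add_le _ _).trans (add_le_add h₁ ?_)
  rw [norm_conj hk]
  exact h₂

theorem smul_mem_lieP {x : Matrix ι ι ℝ} (hx : x ∈ R.lieP) (r : ℝ) : r • x ∈ R.lieP :=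
  ⟨R.lieSubmodule.smul_mem r hx.1, by rw [transpose_smul, hx.2]⟩

theorem isPolar_of_mem_maximalCompact {k : G} (hk : k ∈ R.maximalCompact) : R.IsPolar k 0 :=
  ⟨⟨R.lieSubmodule.zero_mem, by simp⟩, k, hk, 1, R.one_mem_maximalCompact, by simp [mat_one]⟩

theorem exists_conj_sub_le_nat [IsTopologicalGroup G] [ConnectedSpace G] {w : Matrix ι ι ℝ}
    (hw : w ∈ R.lieP) (n : ℕ) {g g' m₁ m₂ : G} {x y : Matrix ι ι ℝ} (hg : R.IsPolar g x)
    (hm₁ : m₁ ∈ R.maximalCompact) (hm₂ : m₂ ∈ R.maximalCompact)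
    (hg' : R.mat g' = R.mat m₁ * NormedSpace.exp ((n : ℝ) • w) * R.mat m₂)
    (hgg' : R.IsPolar (g * g') y) :
    ∃ k ∈ R.maximalCompact, ‖x - R.mat k * y * R.mat k⁻¹‖ ≤
      n * (1 / 2 * ‖NormedSpace.exp w - NormedSpace.exp (-w)‖) := by
  induction n generalizing g' m₂ y with
  | zero =>
    have h0 : g' = m₁ * m₂ := R.mat_injective (by rw [hg', mat_mul]; simp)
    have := hg.exists_conj_sub_le_sinh hgg'
      (isPolar_of_mem_maximalCompact (h0 ▸ R.mul_mem_maximalCompact hm₁ hm₂))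
    simpa using this
  | succ n ih =>
    obtain ⟨a, ha⟩ := R.exists_mat_eq_exp (smul_mem_lieP hw (n : ℝ)).1
    obtain ⟨b, hb⟩ := R.exists_mat_eq_exp hw.1
    have h1 : g' = (m₁ * a) * (b * m₂) := R.mat_injective (by
      rw [hg', mat_mul, mat_mul, mat_mul, ha, hb, Nat.cast_succ, add_smul, one_smul,
        Matrix.exp_add_of_commute _ _ ((Commute.refl w).smul_left _)]
      simp only [mul_assoc])
    obtain ⟨z, hz⟩ := exists_isPolar (R := R) (g * (m₁ * a))
    obtain ⟨k, hk, hk'⟩ := ih (g' := m₁ * a) (m₂ := 1) R.one_mem_maximalCompact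
      (by rw [mat_mul, ha, mat_one, mul_one]) hz
    have hgg2 : R.IsPolar (g * (m₁ * a) * (b * m₂)) y := by
      rw [mul_assoc, ← h1]; exact hgg'
    obtain ⟨l, hl, hl'⟩ := hz.exists_conj_sub_le_sinh hgg2
      (v := w) ⟨hw, 1, R.one_mem_maximalCompact, m₂, hm₂, by rw [mat_mul, hb, mat_one, one_mul]⟩
    refine ⟨k * l, R.mul_mem_maximalCompact hk hl, ?_⟩
    refine (conj_sub_le_add hk hk' hl').trans_eq ?_
    push_cast
    ring

theorem tendsto_nat_mul_norm_sinh (v : Matrix ι ι ℝ) :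
    Filter.Tendsto (fun n : ℕ => ((n + 1 : ℕ) : ℝ) * (1 / 2 *
      ‖NormedSpace.exp ((((n + 1 : ℕ) : ℝ)⁻¹) • v) - NormedSpace.exp (-((((n + 1 : ℕ) : ℝ)⁻¹) • v))‖))
      Filter.atTop (𝓝 ‖v‖) := by
  have hd : HasDerivAt (fun t : ℝ => (1 / 2 : ℝ) •
      (NormedSpace.exp (t • v) - NormedSpace.exp (t • (-v)))) v 0 := by
    refine (((hasDerivAt_exp_zero v).sub (hasDerivAt_exp_zero (-v))).const_smul
      (1 / 2 : ℝ)).congr_deriv ?_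
    module
  have h1 : Filter.Tendsto (fun n : ℕ => (((n + 1 : ℕ) : ℝ)⁻¹)) Filter.atTop (𝓝[≠] 0) := by
    rw [tendsto_nhdsWithin_iff]
    refine ⟨?_, Filter.Eventually.of_forall fun n => ?_⟩
    · exact (tendsto_inv_atTop_zero.comp tendsto_natCast_atTop_atTop).comp
        (Filter.tendsto_add_atTop_nat 1)
    · rw [Set.mem_compl_singleton_iff]; positivity
  have h2 := ((hasDerivAt_iff_tendsto_slope.1 hd).comp h1).norm
  refine h2.congr fun n => ?_
  simp only [Function.comp, slope, vsub_eq_sub, sub_zero, inv_inv, zero_smul, smul_neg]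
  rw [neg_zero, sub_self, smul_zero, sub_zero, norm_smul, norm_smul, Real.norm_of_nonneg (by positivity),
    Real.norm_of_nonneg (by positivity)]

/-- The closest element to `A ∈ 𝔭` in the `K`-orbit of `X ∈ 𝔭` commutes with `A`. -/
theorem exists_nearest [IsTopologicalGroup G] {X A : Matrix ι ι ℝ} (hX : X ∈ R.lieP)
    (hA : A ∈ R.lieP) :
    ∃ k ∈ R.maximalCompact, Commute (R.mat k * X * R.mat k⁻¹) A ∧
      ∀ l ∈ R.maximalCompact, ‖A - R.mat k * X * R.mat k⁻¹‖ ≤ ‖A - R.mat l * X * R.mat l⁻¹‖ := by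
  obtain ⟨k, hk, hlie, hmax, -⟩ := R.exists_aligned hX hA
  refine ⟨k, hk, by rwa [Ring.lie_def, sub_eq_zero] at hlie, fun l hl => ?_⟩
  have hexp : ∀ l ∈ R.maximalCompact, ‖A - R.mat l * X * R.mat l⁻¹‖ ^ 2 =
      ‖A‖ ^ 2 - 2 * (R.mat l * X * R.mat l⁻¹ * A).trace + ‖X‖ ^ 2 := fun l hl => by
    rw [norm_sub_sq_real, norm_conj hl, MatrixFrobenius.inner_def, hA.2, trace_mul_comm]
  refine le_of_sq_le_sq ?_ (norm_nonneg _)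
  rw [hexp k hk, hexp l hl]
  linarith [hmax l hl]

theorem IsPolar.exists_conj_sub_le_right [IsTopologicalGroup G] [ConnectedSpace G] {g g' : G}
    {x y v : Matrix ι ι ℝ} (hg : R.IsPolar g x) (hgg' : R.IsPolar (g * g') y)
    (hg' : R.IsPolar g' v) :
    ∃ k ∈ R.maximalCompact, ‖x - R.mat k * y * R.mat k⁻¹‖ ≤ ‖v‖ := by
  obtain ⟨k, hk, -, hmin⟩ := exists_nearest hgg'.1 hg.1
  refine ⟨k, hk, ge_of_tendsto' (tendsto_nat_mul_norm_sinh v) fun n => ?_⟩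
  obtain ⟨hv, m₁, hm₁, m₂, hm₂, hm⟩ := hg'
  have hn : ((n + 1 : ℕ) : ℝ) ≠ 0 := by positivity
  obtain ⟨l, hl, hl'⟩ := exists_conj_sub_le_nat (smul_mem_lieP hv ((n + 1 : ℕ) : ℝ)⁻¹) (n + 1)
    hg hm₁ hm₂ (by rw [smul_smul, mul_inv_cancel₀ hn, one_smul, hm]) hgg'
  exact (hmin l hl).trans hl'

theorem IsPolar.exists_conj_sub_le_left [IsTopologicalGroup G] [ConnectedSpace G] {g g' : G}
    {x y v : Matrix ι ι ℝ} (hg : R.IsPolar g x) (hg'g : R.IsPolar (g' * g) y)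
    (hg' : R.IsPolar g' v) :
    ∃ k ∈ R.maximalCompact, ‖x - R.mat k * y * R.mat k⁻¹‖ ≤ ‖v‖ := by
  have h := hg'g.transpose
  rw [transpose_mul'] at h
  exact hg.transpose.exists_conj_sub_le_right h hg'.transpose

theorem IsPolar.norm_mul_le [IsTopologicalGroup G] [ConnectedSpace G] {g g' : G}
    {x y v : Matrix ι ι ℝ} (hg : R.IsPolar g x) (hgg' : R.IsPolar (g * g') y)
    (hg' : R.IsPolar g' v) : ‖y‖ ≤ ‖x‖ + ‖v‖ := by
  obtain ⟨k, hk, h⟩ := hg.exists_conj_sub_le_right hgg' hg'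
  rw [← norm_conj hk y]
  have := norm_sub_norm_le (R.mat k * y * R.mat k⁻¹) x
  rw [norm_sub_rev] at this
  linarith

theorem exists_norm_isPolar_le [IsTopologicalGroup G] {Q : Set G} (hQ : IsCompact Q) :
    ∃ C : ℝ, 0 ≤ C ∧ ∀ g ∈ Q, ∀ x, R.IsPolar g x → ‖x‖ ≤ C := by
  have hcont : Continuous fun g : G => R.mat g - (R.mat g⁻¹)ᵀ := by
    have h1 := R.continuous_mat
    have h2 : Continuous fun l : G => R.mat l⁻¹ := h1.comp continuous_inv
    fun_prop
  obtain ⟨C, hC⟩ := hQ.exists_bound_of_continuousOn hcont.continuousOn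
  refine ⟨max C 0, le_max_right _ _, fun g hg x hx => ?_⟩
  have h1 := hx.two_mul_norm_le
  have h2 := hC g hg
  have h3 := norm_nonneg x
  exact le_max_of_le_left (by linarith)

theorem exists_isCompact_of_norm_isPolar_le (R : LinearReductive G ι) (r : ℝ) :
    ∃ Q : Set G, IsCompact Q ∧ ∀ g x, R.IsPolar g x → ‖x‖ ≤ r → g ∈ Q := by
  obtain ⟨C, hC⟩ := (isCompact_closedBall (0 : Matrix ι ι ℝ) r).exists_bound_of_continuousOn
    (NormedSpace.exp_continuous (𝔸 := Matrix ι ι ℝ)).continuousOn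
  refine ⟨_, R.isCompact_setOf_norm_le C, fun g x hx hr => ?_⟩
  obtain ⟨hxP, k, hk, k', hk', hg⟩ := hx
  have h1 : ‖R.mat g⁻¹‖ = ‖NormedSpace.exp (-x)‖ := by
    rw [← norm_transpose_eq, mat_inv, hg, inv_transpose_polar hk hk' hxP.2,
      norm_mul_orthogonal hk', norm_orthogonal_mul hk]
  refine ⟨?_, ?_⟩
  · rw [hg, norm_mul_orthogonal hk', norm_orthogonal_mul hk]
    exact hC x (by simpa using hr)
  · rw [h1]
    exact hC (-x) (by simpa using hr)

end LinearReductive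

/-! ### Word lengths -/

namespace IsWordGeneratingSet

variable {Γ : Type*} [Group Γ] [TopologicalSpace Γ] {S : Set Γ}

theorem one_mem (hS : IsWordGeneratingSet S) : (1 : Γ) ∈ S := mem_of_mem_nhds hS.mem_nhds_one

theorem pow_mono (hS : IsWordGeneratingSet S) {m n : ℕ} (h : m ≤ n) : S ^ m ⊆ S ^ n :=
  Set.pow_subset_pow_right hS.one_mem h

theorem exists_mem_pow (hS : IsWordGeneratingSet S) (γ : Γ) : ∃ n : ℕ, γ ∈ S ^ n := by
  have h : γ ∈ Subgroup.closure S := hS.closure_eq_top ▸ Subgroup.mem_top γ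
  induction h using Subgroup.closure_induction with
  | mem x hx => exact ⟨1, by simpa using hx⟩
  | one => exact ⟨0, by simp⟩
  | mul x y _ _ hx hy =>
    obtain ⟨m, hm⟩ := hx
    obtain ⟨n, hn⟩ := hy
    exact ⟨m + n, by rw [pow_add]; exact Set.mul_mem_mul hm hn⟩
  | inv x _ hx =>
    obtain ⟨m, hm⟩ := hx
    refine ⟨m, ?_⟩
    rw [← hS.inv_eq, inv_pow, Set.mem_inv, inv_inv]
    exact hm

theorem mem_pow_wordLength (hS : IsWordGeneratingSet S) (γ : Γ) : γ ∈ S ^ wordLength S γ :=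
  Nat.sInf_mem (hS.exists_mem_pow γ)

theorem wordLength_le {n : ℕ} {γ : Γ} (h : γ ∈ S ^ n) : wordLength S γ ≤ n := Nat.sInf_le h

/-- Compact sets are contained in balls for the word length. -/
theorem exists_subset_pow [IsTopologicalGroup Γ] (hS : IsWordGeneratingSet S) {Q : Set Γ}
    (hQ : IsCompact Q) : ∃ N : ℕ, Q ⊆ S ^ N := by
  have hcover : Q ⊆ ⋃ n : ℕ, interior (S ^ n) := fun γ _ => by
    obtain ⟨n, hn⟩ := hS.exists_mem_pow γ
    refine Set.mem_iUnion.2 ⟨n + 1, mem_interior_iff_mem_nhds.2 ?_⟩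
    have h1 : γ • S ∈ 𝓝 γ := by
      have := smul_mem_nhds_smul γ hS.mem_nhds_one
      rwa [smul_eq_mul, mul_one] at this
    refine Filter.mem_of_superset h1 ?_
    rintro _ ⟨s, hs, rfl⟩
    rw [pow_succ]
    exact Set.mul_mem_mul hn hs
  obtain ⟨n, hn⟩ := hQ.elim_directed_cover _ (fun n => isOpen_interior) hcover
    (directed_of_isDirected_le fun m n h => interior_mono (hS.pow_mono h))
  exact ⟨n, hn.trans interior_subset⟩

/-- Word lengths are linearly bounded by the number of factors from a compact set. -/
theorem exists_wordLength_le_mul [IsTopologicalGroup Γ] (hS : IsWordGeneratingSet S) {Q : Set Γ}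
    (hQ : IsCompact Q) :
    ∃ N : ℕ, 0 < N ∧ ∀ n : ℕ, ∀ γ ∈ Q ^ n, wordLength S γ ≤ N * n := by
  obtain ⟨N, hN⟩ := hS.exists_subset_pow hQ
  refine ⟨N + 1, Nat.succ_pos N, fun n γ hγ => wordLength_le ?_⟩
  rw [pow_mul]
  exact Set.pow_subset_pow_left (hN.trans (hS.pow_mono (Nat.le_succ N))) hγ

end IsWordGeneratingSet

theorem isCompactlyGeneratedGroup_of_connectedSpace (G : Type*) [Group G] [TopologicalSpace G]
    [IsTopologicalGroup G] [ConnectedSpace G] [LocallyCompactSpace G] :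
    IsCompactlyGeneratedGroup G := by
  obtain ⟨C, hC, hC1⟩ := exists_compact_mem_nhds (1 : G)
  refine ⟨C, hC, ?_⟩
  have hopen : IsOpen (Subgroup.closure C : Set G) :=
    Subgroup.isOpen_of_mem_nhds _ (Filter.mem_of_superset hC1 Subgroup.subset_closure)
  have hclopen : IsClopen (Subgroup.closure C : Set G) :=
    ⟨Subgroup.isClosed_of_isOpen _ hopen, hopen⟩
  exact SetLike.coe_injective (by simpa using hclopen.eq_univ ⟨1, Subgroup.one_mem _⟩)

theorem IsCompactlyGeneratedGroup.exists_isWordGeneratingSet {G : Type*} [Group G]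
    [TopologicalSpace G] [IsTopologicalGroup G] [LocallyCompactSpace G]
    (h : IsCompactlyGeneratedGroup G) : ∃ S : Set G, IsWordGeneratingSet S := by
  obtain ⟨S, hS, hgen⟩ := h
  obtain ⟨C, hC, hC1⟩ := exists_compact_mem_nhds (1 : G)
  refine ⟨(S ∪ C) ∪ (S ∪ C)⁻¹, (hS.union hC).union (hS.union hC).inv,
    by rw [Set.union_inv, inv_inv, Set.union_comm],
    Filter.mem_of_superset hC1 (Set.subset_union_right.trans Set.subset_union_left), ?_⟩
  exact top_le_iff.1 (hgen ▸ Subgroup.closure_mono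
    (Set.subset_union_left.trans Set.subset_union_left))

/-! ### Proper and cocompact actions on homogeneous spaces -/

/-- If `Γ` acts cocompactly on `G/H`, then `G = Γ D H` for some compact set `D`. -/
theorem ActsCocompactly.exists_isCompact {G : Type*} [Group G] [TopologicalSpace G]
    [IsTopologicalGroup G] [LocallyCompactSpace G] {Γ H : Subgroup G} (h : ActsCocompactly Γ H) :
    ∃ D : Set G, IsCompact D ∧ ∀ g : G, ∃ γ ∈ Γ, ∃ d ∈ D, ∃ h ∈ H, g = γ * d * h := by
  have : CompactSpace (Quotient (MulAction.orbitRel Γ (G ⧸ H))) := h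
  let π : G → Quotient (MulAction.orbitRel Γ (G ⧸ H)) := fun g => Quotient.mk _ (g : G ⧸ H)
  have : ContinuousConstSMul Γ (G ⧸ H) :=
    ⟨fun γ => continuous_const_smul (T := G ⧸ H) (γ : G)⟩
  have hπ : IsOpenMap π :=
    (isOpenMap_quotient_mk'_mul (Γ := Γ) (T := G ⧸ H)).comp QuotientGroup.isOpenMap_coe
  choose C hC hCn using fun g : G => exists_compact_mem_nhds g
  have hcover : (Set.univ : Set (Quotient (MulAction.orbitRel Γ (G ⧸ H)))) ⊆
      ⋃ g : G, π '' interior (C g) := fun q _ => by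
    obtain ⟨x, rfl⟩ := Quotient.exists_rep q
    obtain ⟨g, rfl⟩ := QuotientGroup.mk_surjective x
    exact Set.mem_iUnion.2 ⟨g, g, mem_interior_iff_mem_nhds.2 (hCn g), rfl⟩
  obtain ⟨t, ht⟩ := isCompact_univ.elim_finite_subcover _
    (fun g => hπ _ isOpen_interior) hcover
  refine ⟨⋃ g ∈ t, C g, t.isCompact_biUnion fun g _ => hC g, fun g => ?_⟩
  obtain ⟨a, ha, d, hd, hdg⟩ := Set.mem_iUnion₂.1 (ht (Set.mem_univ (π g)))
  have hrel : (g : G ⧸ H) ∈ MulAction.orbit Γ (d : G ⧸ H) :=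
    MulAction.orbitRel_apply.1 (Quotient.exact hdg.symm)
  obtain ⟨γ, hγ⟩ := hrel
  have hγ' : ((γ * d : G) : G ⧸ H) = (g : G ⧸ H) := hγ
  refine ⟨γ, γ.2, d, Set.mem_iUnion₂.2 ⟨a, ha, interior_subset hd⟩, (γ * d)⁻¹ * g,
    QuotientGroup.eq.1 hγ', by group⟩

/-- `Γ` meets each set `C₁ H C₂` with `C₁`, `C₂` compact in a relatively compact set. -/
def MeetsProperly {G : Type*} [Group G] [TopologicalSpace G] (Γ H : Subgroup G) : Prop :=
  ∀ C₁ C₂ : Set G, IsCompact C₁ → IsCompact C₂ → ∃ Q : Set Γ, IsCompact Q ∧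
    ∀ γ : Γ, ∀ c₁ ∈ C₁, ∀ h ∈ H, ∀ c₂ ∈ C₂, (γ : G) = c₁ * h * c₂ → γ ∈ Q

section

variable {G : Type*} [Group G] [TopologicalSpace G] [IsTopologicalGroup G] {Γ H : Subgroup G}

theorem smul_mk_inv_eq {γ : Γ} {c₁ h c₂ : G} (hh : h ∈ H) (he : (γ : G) = c₁ * h * c₂) :
    γ • ((c₂⁻¹ : G) : G ⧸ H) = (c₁ : G ⧸ H) := by
  change (((γ : G) * c₂⁻¹ : G) : G ⧸ H) = c₁
  rw [he, mul_inv_cancel_right, QuotientGroup.mk_mul_of_mem _ hh]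

theorem meetsProperly_of_properlyDiscontinuousSMul [ProperlyDiscontinuousSMul Γ (G ⧸ H)] :
    MeetsProperly Γ H := by
  intro C₁ C₂ h₁ h₂
  have hfin := ProperlyDiscontinuousSMul.finite_disjoint_inter_image (Γ := Γ)
    (h₂.inv.image (QuotientGroup.continuous_mk (N := H)))
    (h₁.image (QuotientGroup.continuous_mk (N := H)))
  refine ⟨_, hfin.isCompact, fun γ c₁ hc₁ h hh c₂ hc₂ he => ?_⟩
  exact ⟨(c₁ : G ⧸ H), ⟨_, ⟨c₂⁻¹, Set.inv_mem_inv.2 hc₂, rfl⟩, smul_mk_inv_eq hh he⟩, c₁, hc₁, rfl⟩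

theorem meetsProperly_of_properSMul [ProperSMul Γ (G ⧸ H)] : MeetsProperly Γ H := by
  intro C₁ C₂ h₁ h₂
  have hcomp := (ProperSMul.isProperMap_smul_pair (G := Γ) (X := G ⧸ H)).isCompact_preimage
    ((h₁.image (QuotientGroup.continuous_mk (N := H))).prod
      (h₂.inv.image (QuotientGroup.continuous_mk (N := H))))
  refine ⟨_, hcomp.image continuous_fst, fun γ c₁ hc₁ h hh c₂ hc₂ he => ?_⟩
  refine ⟨(γ, ((c₂⁻¹ : G) : G ⧸ H)), ⟨?_, c₂⁻¹, Set.inv_mem_inv.2 hc₂, rfl⟩, rfl⟩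
  exact ⟨c₁, hc₁, (smul_mk_inv_eq hh he).symm⟩

end

/-! ### Descent along the distance to `μ(H)` -/

namespace LinearReductive

open Matrix

variable {G : Type*} [Group G] [TopologicalSpace G] {ι : Type*} [Fintype ι] [DecidableEq ι]
variable {R : LinearReductive G ι}

theorem norm_sub_conj_comm {k : G} (hk : k ∈ R.maximalCompact) (x y : Matrix ι ι ℝ) :
    ‖y - R.mat k⁻¹ * x * R.mat k⁻¹⁻¹‖ = ‖x - R.mat k * y * R.mat k⁻¹‖ := by
  rw [← norm_conj hk (y - _), mul_sub, sub_mul, conj_conj, mul_inv_cancel, inv_one, mat_one,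
    one_mul, mul_one, norm_sub_rev]

/-- Alignment of `γ` with `h`: there is a geodesic `t ↦ E t` in `exp 𝔭`, of length the distance
between the `K`-orbits of the polar components, along which `γ` can be moved towards `K h K` by
right multiplication by elements of bounded size. -/
theorem exists_alignment [IsTopologicalGroup G] {γ h : G} {a b : Matrix ι ι ℝ}
    (hγ : R.IsPolar γ a) (hh : R.IsPolar h b) :
    ∃ v ∈ R.lieP, (∀ l ∈ R.maximalCompact, ‖v‖ ≤ ‖a - R.mat l * b * R.mat l⁻¹‖) ∧
      ∃ E : ℝ → G, (∀ t, R.mat (E t) = NormedSpace.exp (t • v)) ∧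
      ∃ k ∈ R.maximalCompact, ∃ k' ∈ R.maximalCompact, ∃ κ₁ ∈ R.maximalCompact,
      ∃ κ ∈ R.maximalCompact, ∀ t, γ * (k'⁻¹ * E (-t) * k') = k * E (1 - t) * κ₁ * h * κ := by
  obtain ⟨k₀, hk₀, hcomm, hmin⟩ := exists_nearest hh.1 hγ.1
  obtain ⟨ha, k, hk, k', hk', hγ⟩ := hγ
  obtain ⟨hb, m, hm, m', hm', hh⟩ := hh
  set b' := R.mat k₀ * b * R.mat k₀⁻¹
  have hb' : b' ∈ R.lieP := R.conj_mem_lieP hk₀ hb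
  have hv : a - b' ∈ R.lieP :=
    ⟨R.lieSubmodule.sub_mem ha.1 hb'.1, by rw [transpose_sub, ha.2, hb'.2]⟩
  have hva : Commute (a - b') a := (Commute.refl a).sub_left hcomm
  have hvb : Commute (a - b') b' := hcomm.symm.sub_left (Commute.refl b')
  choose E hE using hv.1
  obtain ⟨ea, hea⟩ := R.exists_mat_eq_exp ha.1
  obtain ⟨eb, heb⟩ := R.exists_mat_eq_exp hb.1
  have h1 : γ = k * ea * k' := R.mat_injective (by rw [hγ, mat_mul, mat_mul, hea])
  have h2 : h = m * eb * m' := R.mat_injective (by rw [hh, mat_mul, mat_mul, heb])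
  have h3 : ea = E 1 * (k₀ * eb * k₀⁻¹) := R.mat_injective (by
    have : NormedSpace.exp b' = R.mat (k₀ * eb * k₀⁻¹) := by
      rw [mat_mul, mat_mul, heb, R.mat_inv_eq_transpose hk₀, ← exp_orthogonal_conj hk₀,
        ← R.mat_inv_eq_transpose hk₀]
    rw [mat_mul, ← this, hE, one_smul, ← Matrix.exp_add_of_commute _ _ hvb, sub_add_cancel, hea])
  have h4 : ∀ t, ea * E t = E t * ea := fun t => R.mat_injective (by
    rw [mat_mul, mat_mul, hea, hE]
    exact ((hva.smul_left t).exp).symm.eq)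
  have h5 : ∀ s t, E s * E t = E (s + t) := fun s t => R.mat_injective (by
    rw [mat_mul, hE, hE, hE, add_smul, Matrix.exp_add_of_commute _ _
      (((Commute.refl _).smul_left s).smul_right t)])
  refine ⟨a - b', hv, hmin, E, hE, k, hk, k', hk', k₀ * m⁻¹,
    R.mul_mem_maximalCompact hk₀ (R.inv_mem_maximalCompact hm), m'⁻¹ * k₀⁻¹ * k',
    R.mul_mem_maximalCompact (R.mul_mem_maximalCompact (R.inv_mem_maximalCompact hm')
      (R.inv_mem_maximalCompact hk₀)) hk', fun t => ?_⟩
  calc γ * (k'⁻¹ * E (-t) * k') = k * (ea * E (-t)) * k' := by rw [h1]; group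
    _ = k * (E (-t) * E 1) * (k₀ * eb * k₀⁻¹) * k' := by rw [h4, h3]; group
    _ = k * E (1 - t) * (k₀ * eb * k₀⁻¹) * k' := by rw [h5, neg_add_eq_sub]
    _ = _ := by rw [h2]; group

/-- Proper cocompact actions: an element of `Γ` whose polar component is at distance at most `n`
from those of `H` is a product of `n + 1` elements of a fixed compact set. -/
theorem exists_isCompact_mem_pow [IsTopologicalGroup G] [ConnectedSpace G] {Γ H : Subgroup G}
    (hproper : MeetsProperly Γ H) {D : Set G} (hD : IsCompact D)
    (hcover : ∀ g : G, ∃ γ ∈ Γ, ∃ d ∈ D, ∃ h ∈ H, g = γ * d * h) :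
    ∃ Q : Set Γ, IsCompact Q ∧ ∀ (n : ℕ) (γ : Γ), ∀ h ∈ H, ∀ a b, R.IsPolar (γ : G) a →
      R.IsPolar h b → (∃ k ∈ R.maximalCompact, ‖a - R.mat k * b * R.mat k⁻¹‖ ≤ n) →
      γ ∈ Q ^ (n + 1) := by
  obtain ⟨c₀, hc₀, hDc⟩ := exists_norm_isPolar_le (R := R) hD.inv
  obtain ⟨B, hB, hBmem⟩ := R.exists_isCompact_of_norm_isPolar_le (c₀ + 1)
  obtain ⟨Q₀, hQ₀, hQ₀mem⟩ := hproper B R.maximalCompact hB R.isCompact_maximalCompact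
  obtain ⟨Q₁, hQ₁, hQ₁mem⟩ := hproper B D⁻¹ hB hD.inv
  have h1Q : (1 : Γ) ∈ Q₀ ∪ Q₁⁻¹ ∪ {1} := Set.mem_union_right _ rfl
  refine ⟨Q₀ ∪ Q₁⁻¹ ∪ {1}, (hQ₀.union hQ₁.inv).union isCompact_singleton, fun n => ?_⟩
  have hbase : ∀ (n : ℕ) (γ : Γ), ∀ h ∈ H, ∀ v ∈ R.lieP, ‖v‖ ≤ c₀ + 1 → ∀ e k κ₁ κ, R.mat e = NormedSpace.exp v →
      k ∈ R.maximalCompact → κ₁ ∈ R.maximalCompact → κ ∈ R.maximalCompact →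
      (γ : G) = k * e * κ₁ * h * κ → γ ∈ (Q₀ ∪ Q₁⁻¹ ∪ {1}) ^ (n + 1) := by
    intro n γ h hh v hv hvn e k κ₁ κ he hk hκ₁ hκ hγ
    have hmem : γ ∈ Q₀ := hQ₀mem γ (k * e * κ₁)
      (hBmem _ v ⟨hv, k, hk, κ₁, hκ₁, by rw [mat_mul, mat_mul, he]⟩ hvn) h hh κ hκ hγ
    have h2 : γ ∈ (Q₀ ∪ Q₁⁻¹ ∪ {1}) ^ 1 := by
      rw [pow_one]; exact Set.mem_union_left _ (Set.mem_union_left _ hmem)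
    exact Set.pow_subset_pow_right h1Q (Nat.succ_le_succ (Nat.zero_le n)) h2
  induction n with
  | zero =>
    intro γ h hh a b ha hb ⟨l, hl, hln⟩
    obtain ⟨v, hv, hmin, E, hE, k, hk, k', hk', κ₁, hκ₁, κ, hκ, hgeo⟩ := exists_alignment ha hb
    have hvn : ‖v‖ ≤ 0 := by simpa using (hmin l hl).trans hln
    have hE0 : E 0 = 1 := R.mat_injective (by rw [hE, mat_one]; simp)
    have := hgeo 0
    rw [neg_zero, hE0, mul_one, inv_mul_cancel, mul_one, sub_zero] at this
    exact hbase 0 γ h hh v hv (by linarith) (E 1) k κ₁ κ (by rw [hE, one_smul]) hk hκ₁ hκ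
      this
  | succ n ih =>
    intro γ h hh a b ha hb ⟨l, hl, hln⟩
    obtain ⟨v, hv, hmin, E, hE, k, hk, k', hk', κ₁, hκ₁, κ, hκ, hgeo⟩ := exists_alignment ha hb
    have hvn : ‖v‖ ≤ n + 1 := by simpa using (hmin l hl).trans hln
    have hE0 : E 0 = 1 := R.mat_injective (by rw [hE, mat_one]; simp)
    rcases le_or_gt ‖v‖ (c₀ + 1) with hsmall | hlarge
    · have := hgeo 0
      rw [neg_zero, hE0, mul_one, inv_mul_cancel, mul_one, sub_zero] at this
      exact hbase (n + 1) γ h hh v hv hsmall (E 1) k κ₁ κ (by rw [hE, one_smul]) hk hκ₁ hκ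
        this
    have hvpos : 0 < ‖v‖ := by linarith
    set t := (c₀ + 1) / ‖v‖
    have ht0 : 0 ≤ t := by positivity
    have ht1 : t ≤ 1 := (div_le_one hvpos).2 hlarge.le
    have htv : t * ‖v‖ = c₀ + 1 := div_mul_cancel₀ _ hvpos.ne'
    have hgeo := hgeo t
    set β := k'⁻¹ * E (-t) * k' * κ⁻¹
    have hβB : β ∈ B := by
      refine hBmem β ((-t) • v) ⟨smul_mem_lieP hv _, k'⁻¹, R.inv_mem_maximalCompact hk', k' * κ⁻¹,
        R.mul_mem_maximalCompact hk' (R.inv_mem_maximalCompact hκ), ?_⟩ ?_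
      · rw [show β = k'⁻¹ * E (-t) * (k' * κ⁻¹) by simp only [β, mul_assoc], mat_mul, mat_mul, hE]
      · rw [norm_smul, norm_neg, Real.norm_of_nonneg ht0, htv]
    obtain ⟨γb, hγb, d, hd, hb', hhb', hβ⟩ := hcover β
    have hγbQ : (⟨γb, hγb⟩ : Γ) ∈ Q₁ := hQ₁mem ⟨γb, hγb⟩ β hβB hb'⁻¹ (H.inv_mem hhb') d⁻¹
      (Set.inv_mem_inv.2 hd) (by rw [hβ]; group)
    have hγ' : (γ : G) * γb = k * E (1 - t) * κ₁ * (h * hb'⁻¹ * d⁻¹) := by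
      calc (γ : G) * γb = γ * (k'⁻¹ * E (-t) * k') * κ⁻¹ * hb'⁻¹ * d⁻¹ := by
            have : γb = β * hb'⁻¹ * d⁻¹ := by rw [hβ]; group
            rw [this]; simp only [β, mul_assoc]
        _ = _ := by rw [hgeo]; group
    obtain ⟨y, hy⟩ := exists_isPolar (R := R) ((γ : G) * γb)
    obtain ⟨z, hz⟩ := exists_isPolar (R := R) (h * hb'⁻¹ * d⁻¹)
    obtain ⟨x, hx⟩ := exists_isPolar (R := R) (h * hb'⁻¹)
    obtain ⟨w, hw⟩ := exists_isPolar (R := R) d⁻¹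
    have hpol : R.IsPolar (k * E (1 - t) * κ₁) ((1 - t) • v) :=
      ⟨smul_mem_lieP hv _, k, hk, κ₁, hκ₁, by rw [mat_mul, mat_mul, hE]⟩
    obtain ⟨l₁, hl₁, h₁⟩ := hz.exists_conj_sub_le_left (hγ' ▸ hy) hpol
    obtain ⟨l₂, hl₂, h₂⟩ := hx.exists_conj_sub_le_right hz hw
    have h₃ := conj_sub_le_add hl₂ h₂ h₁
    have hl₂₁ := R.mul_mem_maximalCompact hl₂ hl₁
    have hwc : ‖w‖ ≤ c₀ := hDc d⁻¹ (Set.inv_mem_inv.2 hd) w hw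
    have hnorm : ‖(1 - t) • v‖ = ‖v‖ - (c₀ + 1) := by
      rw [norm_smul, Real.norm_of_nonneg (by linarith), sub_mul, one_mul, htv]
    have hfin := ih (γ * ⟨γb, hγb⟩) (h * hb'⁻¹) (H.mul_mem hh (H.inv_mem hhb')) y x hy hx
      ⟨(l₂ * l₁)⁻¹, R.inv_mem_maximalCompact hl₂₁, by
        rw [norm_sub_conj_comm hl₂₁]
        refine h₃.trans ?_
        rw [hnorm]
        linarith⟩
    rw [pow_succ]
    refine ⟨γ * ⟨γb, hγb⟩, hfin, ⟨γb, hγb⟩⁻¹, ?_, by simp⟩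
    exact Set.mem_union_left _ (Set.mem_union_right _ (Set.inv_mem_inv.2 hγbQ))

end LinearReductive

/-! ### Cartan projections and word lengths -/

theorem Subgroup.coe_mem_image_pow {G : Type*} [Group G] {Γ : Subgroup G} {S : Set Γ} {n : ℕ} {γ : Γ}
    (h : γ ∈ S ^ n) :
    (γ : G) ∈ (Γ.subtype '' S) ^ n := by
  rw [← Set.image_pow]
  exact ⟨γ, h, rfl⟩

/-- Euclidean norms on a finite-dimensional normed space are equivalent to its norm. -/
theorem IsScalarProduct.exists_euclNorm_bounds {E : Type*} [NormedAddCommGroup E]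
    [NormedSpace ℝ E] [FiniteDimensional ℝ E] {B : LinearMap.BilinForm ℝ E} (hB : IsScalarProduct B) :
    ∃ c₁ c₂ : ℝ, 0 < c₁ ∧ 0 < c₂ ∧
      ∀ x : E, c₁ * ‖x‖ ≤ euclNorm B x ∧ euclNorm B x ≤ c₂ * ‖x‖ := by
  let f : E →ₗ[ℝ] E →L[ℝ] ℝ := LinearMap.toContinuousLinearMap.toLinearMap ∘ₗ B
  have hcont : Continuous (euclNorm B) := by
    have h1 : Continuous f := f.continuous_of_finiteDimensional
    exact Real.continuous_sqrt.comp (h1.clm_apply continuous_id)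
  have := FiniteDimensional.proper_real E
  have hsph := isCompact_sphere (0 : E) 1
  obtain ⟨c₁, hc₁, h₁⟩ := hsph.exists_forall_le' hcont.continuousOn (a := 0) fun u hu =>
    Real.sqrt_pos.2 (hB.pos u (by rintro rfl; simp at hu))
  obtain ⟨c₂, h₂⟩ := hsph.exists_bound_of_continuousOn hcont.continuousOn
  refine ⟨c₁, max c₂ 1, hc₁, lt_max_of_lt_right one_pos, fun x => ?_⟩
  rcases eq_or_ne x 0 with rfl | hx
  · simp [euclNorm]
  have hx' := norm_pos_iff.2 hx
  have hu : ‖x‖⁻¹ • x ∈ Metric.sphere (0 : E) 1 := by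
    simp [norm_smul, hx'.ne']
  have hscale : euclNorm B x = ‖x‖ * euclNorm B (‖x‖⁻¹ • x) := by
    have : B x x = ‖x‖ ^ 2 * B (‖x‖⁻¹ • x) (‖x‖⁻¹ • x) := by
      simp only [map_smul, LinearMap.smul_apply, smul_eq_mul]
      field_simp
    rw [euclNorm, euclNorm, this, Real.sqrt_mul (by positivity), Real.sqrt_sq hx'.le]
  rw [hscale, mul_comm ‖x‖]
  refine ⟨mul_le_mul_of_nonneg_right (h₁ _ hu) hx'.le, mul_le_mul_of_nonneg_right ?_ hx'.le⟩
  exact (le_abs_self _).trans ((h₂ _ hu).trans (le_max_left _ _))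

namespace LinearReductive

open Matrix

variable {G : Type*} [Group G] [TopologicalSpace G] {ι : Type*} [Fintype ι] [DecidableEq ι]
variable {R : LinearReductive G ι} {𝔞 : Submodule ℝ (Matrix ι ι ℝ)} {Δ : Set (Module.Dual ℝ 𝔞)}

theorem t2Space (R : LinearReductive G ι) : T2Space G := R.isClosedEmbedding.isEmbedding.t2Space

theorem locallyCompactSpace (R : LinearReductive G ι) : LocallyCompactSpace G :=
  R.isClosedEmbedding.locallyCompactSpace

theorem euclDistTo_le {E : Type*} [AddCommGroup E] [Module ℝ E] (B : LinearMap.BilinForm ℝ E)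
    (x : E) {s : Set E} {y : E} (hy : y ∈ s) : euclDistTo B x s ≤ euclNorm B (x - y) :=
  ciInf_le (f := fun y : s => euclNorm B (x - y))
    ⟨0, by rintro _ ⟨y, rfl⟩; exact Real.sqrt_nonneg _⟩ ⟨y, hy⟩

variable [IsTopologicalGroup G] [ConnectedSpace G]

theorem isPolar_cartanProjection (h𝔞 : R.IsCartanSubspace 𝔞) (hΔ : R.IsSimpleSystem 𝔞 Δ) (g : G) :
    R.IsPolar g (R.cartanProjection 𝔞 Δ g : Matrix ι ι ℝ) :=
  ⟨h𝔞.1.1 (R.cartanProjection 𝔞 Δ g).2, (isCartanComponent_cartanProjection h𝔞 hΔ g).2⟩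

theorem cartanProjection_one (h𝔞 : R.IsCartanSubspace 𝔞) (hΔ : R.IsSimpleSystem 𝔞 Δ) :
    R.cartanProjection 𝔞 Δ 1 = 0 := by
  have h := (isPolar_cartanProjection h𝔞 hΔ (1 : G)).two_mul_norm_le
  rw [inv_one, mat_one, transpose_one, sub_self, norm_zero] at h
  have h0 : ‖(R.cartanProjection 𝔞 Δ 1 : Matrix ι ι ℝ)‖ = 0 :=
    le_antisymm (by linarith) (norm_nonneg _)
  exact Subtype.ext (norm_eq_zero.1 h0)

/-- The norm of the Cartan projection grows at most linearly with the number of factors from a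
compact set. -/
theorem exists_norm_cartanProjection_le (h𝔞 : R.IsCartanSubspace 𝔞) (hΔ : R.IsSimpleSystem 𝔞 Δ)
    {T : Set G} (hT : IsCompact T) :
    ∃ C : ℝ, 0 < C ∧ ∀ (n : ℕ), ∀ g ∈ T ^ n, ‖R.cartanProjection 𝔞 Δ g‖ ≤ C * n := by
  obtain ⟨C, hC, hCT⟩ := exists_norm_isPolar_le (R := R) hT
  refine ⟨C + 1, by linarith, fun n => ?_⟩
  induction n with
  | zero =>
    intro g hg
    rw [pow_zero, Set.mem_one] at hg
    rw [hg, cartanProjection_one h𝔞 hΔ]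
    simp
  | succ n ih =>
    intro g hg
    rw [pow_succ] at hg
    obtain ⟨a, ha, b, hb, rfl⟩ := hg
    have h1 := (isPolar_cartanProjection h𝔞 hΔ a).norm_mul_le
      (isPolar_cartanProjection h𝔞 hΔ (a * b)) (isPolar_cartanProjection h𝔞 hΔ b)
    have h2 := hCT b hb _ (isPolar_cartanProjection h𝔞 hΔ b)
    have h3 := ih a ha
    push_cast
    change ‖(R.cartanProjection 𝔞 Δ (a * b) : Matrix ι ι ℝ)‖ ≤ _
    change ‖(R.cartanProjection 𝔞 Δ a : Matrix ι ι ℝ)‖ ≤ _ at h3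
    linarith

/-- The word length in `G` is linearly bounded by the norm of the Cartan projection. -/
theorem exists_wordLength_le_norm (h𝔞 : R.IsCartanSubspace 𝔞) (hΔ : R.IsSimpleSystem 𝔞 Δ)
    {T : Set G} (hT : IsWordGeneratingSet T) :
    ∃ N : ℝ, 0 < N ∧ ∀ g : G, (wordLength T g : ℝ) ≤ N * (‖R.cartanProjection 𝔞 Δ g‖ + 4) := by
  obtain ⟨Q, hQ, hQmem⟩ := R.exists_isCompact_of_norm_isPolar_le 1
  obtain ⟨N, hN, hwl⟩ := hT.exists_wordLength_le_mul hQ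
  refine ⟨N, by exact_mod_cast hN, fun g => ?_⟩
  obtain ⟨ha, k, hk, k', hk', hg⟩ := isPolar_cartanProjection h𝔞 hΔ g
  set a := R.cartanProjection 𝔞 Δ g
  set m := ⌈‖a‖⌉₊
  have hm1 : ((m + 1 : ℕ) : ℝ) ≠ 0 := by positivity
  have ha' := smul_mem_lieP ha (((m + 1 : ℕ) : ℝ)⁻¹)
  obtain ⟨e, he⟩ := R.exists_mat_eq_exp ha'.1
  have hKQ : ∀ l ∈ R.maximalCompact, l ∈ Q := fun l hl =>
    hQmem l 0 (isPolar_of_mem_maximalCompact hl) (by simp)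
  have heQ : e ∈ Q := by
    refine hQmem e _ ⟨ha', 1, R.one_mem_maximalCompact, 1, R.one_mem_maximalCompact,
      by rw [he, mat_one, one_mul, mul_one]⟩ ?_
    rw [norm_smul, norm_inv, Real.norm_of_nonneg (by positivity),
      inv_mul_le_iff₀ (by positivity), mul_one]
    have : ‖a‖ ≤ m := Nat.le_ceil _
    push_cast
    change ‖a‖ ≤ _
    linarith
  have hge : g = k * e ^ (m + 1) * k' := R.mat_injective (by
    rw [hg, mat_mul, mat_mul, mat_pow, he, ← Matrix.exp_nsmul, ← Nat.cast_smul_eq_nsmul ℝ,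
      smul_smul, mul_inv_cancel₀ hm1, one_smul])
  have hgQ : g ∈ Q ^ (1 + (m + 1) + 1) := by
    rw [hge, pow_add, pow_add, pow_one]
    exact Set.mul_mem_mul (Set.mul_mem_mul (hKQ k hk) (Set.pow_mem_pow heQ)) (hKQ k' hk')
  have h1 : (wordLength T g : ℝ) ≤ N * ((1 + (m + 1) + 1 : ℕ) : ℝ) := by
    exact_mod_cast hwl _ g hgQ
  have h2 : (m : ℝ) < ‖a‖ + 1 := Nat.ceil_lt_add_one (norm_nonneg _)
  refine h1.trans (mul_le_mul_of_nonneg_left ?_ (Nat.cast_nonneg N))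
  push_cast
  linarith

/-- A subgroup acting properly and cocompactly on `G/H` is compactly generated and sharply
embedded. -/
theorem isSharplyEmbedded_of_meetsProperly (h𝔞 : R.IsCartanSubspace 𝔞)
    (hΔ : R.IsSimpleSystem 𝔞 Δ) {B : LinearMap.BilinForm ℝ 𝔞} (hB : IsScalarProduct B)
    {Γ H : Subgroup G} (hproper : MeetsProperly Γ H) (hcocompact : ActsCocompactly Γ H) :
    R.IsSharplyEmbedded 𝔞 Δ B Γ H := by
  have := R.locallyCompactSpace
  obtain ⟨D, hD, hcover⟩ := hcocompact.exists_isCompact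
  obtain ⟨Q, hQ, hpow⟩ := exists_isCompact_mem_pow (R := R) hproper hD hcover
  obtain ⟨c₁, _, hc₁, -, hbounds⟩ := hB.exists_euclNorm_bounds
  have hmem : ∀ (γ : Γ), ∀ h ∈ H, γ ∈ Q ^
      (⌈‖R.cartanProjection 𝔞 Δ (γ : G) - R.cartanProjection 𝔞 Δ h‖⌉₊ + 1) := fun γ h hh => by
    refine hpow _ γ h hh _ _ (isPolar_cartanProjection h𝔞 hΔ _) (isPolar_cartanProjection h𝔞 hΔ _)
      ⟨1, R.one_mem_maximalCompact, ?_⟩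
    rw [inv_one, mat_one, one_mul, mul_one]
    exact Nat.le_ceil _
  refine ⟨⟨Q, hQ, ?_⟩, fun S hS => ?_⟩
  · refine (Subgroup.eq_top_iff' _).2 fun γ => ?_
    have h1 := hmem γ 1 H.one_mem
    have h2 : ∀ n : ℕ, Q ^ n ⊆ (Subgroup.closure Q : Set Γ) := fun n => by
      induction n with
      | zero =>
        rw [pow_zero]
        exact Set.one_subset.2 (Subgroup.one_mem _)
      | succ n ih =>
        rw [pow_succ]
        rintro _ ⟨a, ha, b, hb, rfl⟩
        exact Subgroup.mul_mem _ (ih ha) (Subgroup.subset_closure hb)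
    exact h2 _ h1
  · obtain ⟨N, hN, hwl⟩ := hS.exists_wordLength_le_mul hQ
    have hN' : (0 : ℝ) < N := by exact_mod_cast hN
    refine ⟨c₁ / N, 2 * c₁, by positivity, by positivity, fun γ => ?_⟩
    have : Nonempty (R.cartanProjection 𝔞 Δ '' (H : Set G)) := ⟨⟨_, 1, H.one_mem, rfl⟩⟩
    refine le_ciInf ?_
    rintro ⟨_, h, hh, rfl⟩
    refine le_trans ?_ (hbounds _).1
    set r := ‖R.cartanProjection 𝔞 Δ (γ : G) - R.cartanProjection 𝔞 Δ h‖
    have h1 : (wordLength S γ : ℝ) ≤ N * ((⌈r⌉₊ + 1 : ℕ) : ℝ) := by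
      exact_mod_cast hwl _ γ (hmem γ h hh)
    have h2 : (⌈r⌉₊ : ℝ) < r + 1 := Nat.ceil_lt_add_one (norm_nonneg _)
    have h3 : (wordLength S γ : ℝ) ≤ N * (r + 2) := by
      refine h1.trans (mul_le_mul_of_nonneg_left ?_ hN'.le)
      push_cast
      linarith
    have h4 : c₁ / N * (wordLength S γ : ℝ) ≤ c₁ / N * (N * (r + 2)) :=
      mul_le_mul_of_nonneg_left h3 (by positivity)
    have h5 : c₁ / N * (N * (r + 2)) = c₁ * r + 2 * c₁ := by field_simp
    linarith

theorem IsSharplyEmbedded.isSharp (h𝔞 : R.IsCartanSubspace 𝔞) (hΔ : R.IsSimpleSystem 𝔞 Δ)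
    {B : LinearMap.BilinForm ℝ 𝔞} (hB : IsScalarProduct B) {Γ H : Subgroup G}
    (hΓ : IsClosed (Γ : Set G)) (h : R.IsSharplyEmbedded 𝔞 Δ B Γ H) : R.IsSharp 𝔞 Δ B Γ H := by
  have := R.locallyCompactSpace
  have : LocallyCompactSpace Γ := hΓ.locallyCompactSpace
  obtain ⟨S, hS⟩ := h.1.exists_isWordGeneratingSet
  obtain ⟨C, C', hC, hC', hle⟩ := h.2 S hS
  obtain ⟨A, hA, hAle⟩ := exists_norm_cartanProjection_le h𝔞 hΔ
    (hS.isCompact.image (f := Γ.subtype) continuous_subtype_val)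
  obtain ⟨_, c₂, -, hc₂, hbounds⟩ := hB.exists_euclNorm_bounds
  refine ⟨C / (c₂ * A), C', by positivity, hC', fun γ hγ => le_trans ?_ (hle ⟨γ, hγ⟩)⟩
  have h1 := hAle _ _ (Subgroup.coe_mem_image_pow (hS.mem_pow_wordLength ⟨γ, hγ⟩))
  have h2 : euclNorm B (R.cartanProjection 𝔞 Δ γ) ≤ c₂ * (A * wordLength S (⟨γ, hγ⟩ : Γ)) :=
    (hbounds _).2.trans (mul_le_mul_of_nonneg_left h1 hc₂.le)
  have h3 : C / (c₂ * A) * euclNorm B (R.cartanProjection 𝔞 Δ γ) ≤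
      C / (c₂ * A) * (c₂ * (A * wordLength S (⟨γ, hγ⟩ : Γ))) :=
    mul_le_mul_of_nonneg_left h2 (by positivity)
  have h4 : C / (c₂ * A) * (c₂ * (A * wordLength S (⟨γ, hγ⟩ : Γ))) =
      C * wordLength S (⟨γ, hγ⟩ : Γ) := by field_simp
  linarith

theorem IsSharplyEmbedded.isQuasiIsometricallyEmbedded (h𝔞 : R.IsCartanSubspace 𝔞)
    (hΔ : R.IsSimpleSystem 𝔞 Δ) {B : LinearMap.BilinForm ℝ 𝔞} (hB : IsScalarProduct B)
    {Γ H : Subgroup G} (h : R.IsSharplyEmbedded 𝔞 Δ B Γ H) : IsQuasiIsometricallyEmbedded Γ := by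
  have := R.locallyCompactSpace
  refine ⟨h.1, isCompactlyGeneratedGroup_of_connectedSpace G, fun S T hS hT => ?_⟩
  obtain ⟨C, C', hC, hC', hle⟩ := h.2 S hS
  obtain ⟨A, hA, hAle⟩ := exists_norm_cartanProjection_le h𝔞 hΔ hT.isCompact
  obtain ⟨_, c₂, -, hc₂, hbounds⟩ := hB.exists_euclNorm_bounds
  obtain ⟨N, -, hwl⟩ := hT.exists_wordLength_le_mul
    (hS.isCompact.image (f := Γ.subtype) continuous_subtype_val)
  have hlower : ∀ γ : Γ,
      (wordLength S γ : ℝ) ≤ c₂ * A / C * wordLength T (γ : G) + C' / C := fun γ => by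
    have h1 : euclDistTo B (R.cartanProjection 𝔞 Δ (γ : G))
        (R.cartanProjection 𝔞 Δ '' (H : Set G)) ≤ euclNorm B (R.cartanProjection 𝔞 Δ (γ : G)) := by
      have := euclDistTo_le B (R.cartanProjection 𝔞 Δ (γ : G))
        (s := R.cartanProjection 𝔞 Δ '' (H : Set G)) ⟨1, H.one_mem, rfl⟩
      rwa [cartanProjection_one h𝔞 hΔ, sub_zero] at this
    have h2 := (hbounds (R.cartanProjection 𝔞 Δ (γ : G))).2
    have h3 := mul_le_mul_of_nonneg_left (hAle _ _ (hT.mem_pow_wordLength (γ : G))) hc₂.le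
    have h4 := hle γ
    rw [div_mul_eq_mul_div, ← add_div, le_div_iff₀ hC]
    linarith
  have hupper : ∀ γ : Γ, (wordLength T (γ : G) : ℝ) ≤ N * wordLength S γ := fun γ => by
    exact_mod_cast hwl _ _ (Subgroup.coe_mem_image_pow (hS.mem_pow_wordLength γ))
  set M : ℝ := max 1 (max (c₂ * A / C) N)
  have hM1 : 1 ≤ M := le_max_left _ _
  have hM2 : c₂ * A / C ≤ M := (le_max_left _ _).trans (le_max_right _ _)
  have hM3 : (N : ℝ) ≤ M := (le_max_right _ _).trans (le_max_right _ _)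
  have hM0 : 0 < M := by linarith
  have hCC : 0 ≤ C' / C := by positivity
  refine ⟨M, C' / C, hM1, hCC, fun γ γ' => ⟨?_, ?_⟩⟩
  · have h1 := hlower (γ⁻¹ * γ')
    have h2 : c₂ * A / C * (wordLength T ((γ⁻¹ * γ' : Γ) : G) : ℝ) ≤
        M * wordLength T ((γ⁻¹ * γ' : Γ) : G) :=
      mul_le_mul_of_nonneg_right hM2 (Nat.cast_nonneg _)
    have h3 : C' / C ≤ M * (C' / C) := le_mul_of_one_le_left hCC hM1
    rw [sub_le_iff_le_add, inv_mul_le_iff₀ hM0, mul_add]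
    exact h1.trans (add_le_add h2 h3)
  · have h1 := hupper (γ⁻¹ * γ')
    have h2 : (N : ℝ) * wordLength S (γ⁻¹ * γ') ≤ M * wordLength S (γ⁻¹ * γ') :=
      mul_le_mul_of_nonneg_right hM3 (Nat.cast_nonneg _)
    exact (h1.trans h2).trans (le_add_of_nonneg_right hCC)

theorem IsSharp.isSharplyEmbedded (h𝔞 : R.IsCartanSubspace 𝔞) (hΔ : R.IsSimpleSystem 𝔞 Δ)
    {B : LinearMap.BilinForm ℝ 𝔞} (hB : IsScalarProduct B) {Γ H : Subgroup G}
    (h : R.IsSharp 𝔞 Δ B Γ H) (hqi : IsQuasiIsometricallyEmbedded Γ) :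
    R.IsSharplyEmbedded 𝔞 Δ B Γ H := by
  have := R.locallyCompactSpace
  refine ⟨hqi.1, fun S hS => ?_⟩
  obtain ⟨T, hT⟩ := hqi.2.1.exists_isWordGeneratingSet
  obtain ⟨c, c', hc, hc', hle⟩ := h
  obtain ⟨A, A', hA, hA', hqi⟩ := hqi.2.2 S T hS hT
  obtain ⟨N, hN, hwl⟩ := exists_wordLength_le_norm h𝔞 hΔ hT
  obtain ⟨c₁, _, hc₁, -, hbounds⟩ := hB.exists_euclNorm_bounds
  have hA0 : 0 < A := by linarith
  refine ⟨c * c₁ / N * A⁻¹, c * c₁ / N * A' + 4 * (c * c₁) + c', by positivity, by positivity,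
    fun γ => le_trans ?_ (hle γ γ.2)⟩
  have h1 := (hqi 1 γ).1
  simp only [wordDist, inv_one, one_mul, Subgroup.coe_one] at h1
  have h2 := hwl (γ : G)
  have h3 := (hbounds (R.cartanProjection 𝔞 Δ (γ : G))).1
  set r := ‖R.cartanProjection 𝔞 Δ (γ : G)‖
  have h4 : c * c₁ / N * (A⁻¹ * wordLength S γ - A') ≤ c * c₁ / N * (N * (r + 4)) :=
    mul_le_mul_of_nonneg_left (h1.trans h2) (by positivity)
  have h5 : c * c₁ / N * (N * (r + 4)) = c * (c₁ * r) + 4 * (c * c₁) := by field_simp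
  have h6 := mul_le_mul_of_nonneg_left h3 hc.le
  have h7 : c * c₁ / N * A⁻¹ * wordLength S γ = c * c₁ / N * (A⁻¹ * wordLength S γ) := by ring
  rw [h5, mul_sub] at h4
  rw [h7]
  linarith

end LinearReductive

theorem IsCompactlyGeneratedGroup.fg {Γ : Type*} [Group Γ] [TopologicalSpace Γ]
    [DiscreteTopology Γ] (h : IsCompactlyGeneratedGroup Γ) : Group.FG Γ := by
  obtain ⟨S, hS, hgen⟩ := h
  exact Group.fg_iff.2 ⟨S, hgen, hS.finite_of_discrete⟩


end MatrixFrobeniusNorm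

theorem theorem1p5 {G : Type*} [Group G] [TopologicalSpace G] [IsTopologicalGroup G]
    [ConnectedSpace G] {ι : Type*} [Fintype ι] [DecidableEq ι]
    (R : LinearReductive G ι)
    (𝔞 : Submodule ℝ (Matrix ι ι ℝ)) (h𝔞 : R.IsCartanSubspace 𝔞)
    (Δ : Set (Module.Dual ℝ 𝔞)) (hΔ : R.IsSimpleSystem 𝔞 Δ)
    (B : LinearMap.BilinForm ℝ 𝔞) (hB : IsScalarProduct B)
    (H : Subgroup G) (hH : IsClosed (H : Set G)) :
    -- discrete subgroups acting properly discontinuously and cocompactly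
    (∀ Γ : Subgroup G, DiscreteTopology Γ → ProperlyDiscontinuousSMul Γ (G ⧸ H) →
      ActsCocompactly Γ H →
        Group.FG Γ ∧ R.IsSharplyEmbedded 𝔞 Δ B Γ H ∧
          R.IsSharp 𝔞 Δ B Γ H ∧ IsQuasiIsometricallyEmbedded Γ) ∧
    -- closed subgroups acting properly and cocompactly
    (∀ Γ : Subgroup G, IsClosed (Γ : Set G) → ProperSMul Γ (G ⧸ H) →
      ActsCocompactly Γ H →
        IsCompactlyGeneratedGroup Γ ∧ R.IsSharplyEmbedded 𝔞 Δ B Γ H ∧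
          R.IsSharp 𝔞 Δ B Γ H ∧ IsQuasiIsometricallyEmbedded Γ) ∧
    -- sharply embedded means sharp and quasi-isometrically embedded
    (∀ Γ : Subgroup G, IsClosed (Γ : Set G) → IsCompactlyGeneratedGroup Γ →
      (R.IsSharplyEmbedded 𝔞 Δ B Γ H ↔
        R.IsSharp 𝔞 Δ B Γ H ∧ IsQuasiIsometricallyEmbedded Γ)) := by
  refine ⟨fun Γ hdisc hpd hco => ?_, fun Γ hcl hps hco => ?_, fun Γ hcl _ => ?_⟩
  · have := R.t2Space
    have hcl : IsClosed (Γ : Set G) := Subgroup.isClosed_of_discrete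
    have hemb := LinearReductive.isSharplyEmbedded_of_meetsProperly (R := R) h𝔞 hΔ hB
      meetsProperly_of_properlyDiscontinuousSMul hco
    exact ⟨hemb.1.fg, hemb, hemb.isSharp h𝔞 hΔ hB hcl, hemb.isQuasiIsometricallyEmbedded h𝔞 hΔ hB⟩
  · have hemb := LinearReductive.isSharplyEmbedded_of_meetsProperly (R := R) h𝔞 hΔ hB
      meetsProperly_of_properSMul hco
    exact ⟨hemb.1, hemb, hemb.isSharp h𝔞 hΔ hB hcl, hemb.isQuasiIsometricallyEmbedded h𝔞 hΔ hB⟩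
  · exact ⟨fun hemb => ⟨hemb.isSharp h𝔞 hΔ hB hcl, hemb.isQuasiIsometricallyEmbedded h𝔞 hΔ hB⟩,
      fun h => h.1.isSharplyEmbedded h𝔞 hΔ hB h.2⟩
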